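/- Let $(M_1,g_1)$ and $(M_2,g_2)$ be smooth pseudo-Riemannian manifolds of dimensions $n_1,n_2$ with $n=n_1+n_2\ge 2$, let $f\colon M_1\to(0,\infty)$ be smooth, and let $M=M_1\times_f M_2$ be the singly warped product, i.e. $M_1\times M_2$ with the metric $g=\pi_1^*g_1+(f\circ\pi_1)^2\,\pi_2^*g_2$. For a pseudo-Riemannian metric $h$ with Levi-Civita connection $\nabla$ put $\mathcal R(X,Y)Z=\nabla_Y\nabla_XZ-\nabla_X\nabla_YZ+\nabla_{[X,Y]}Z$, $\mathrm{Ric}(X,Z)=\mathrm{trace}\,(V\mapsto\mathcal R(X,V)Z)$ and let the scalar curvature be the $h$-trace of $\mathrm{Ric}$ (so that it is positive on round spheres). Let $\nabla^i,\mathcal R^i$ be the Levi-Civita connection and curvature tensor of $g_i$, and let $\mathcal R,\tau$ be the curvature tensor and scalar curvature of $g$. The concircular curvature tensor of $M$ is $$\mathcal C(X,Y)Z=\mathcal R(X,Y)Z-\frac{\tau}{n(n-1)}\,[\,g(X,Z)Y-g(Y,Z)X\,].$$ Let $\mathrm{grad}f$ be the gradient of $f$ on $(M_1,g_1)$, $\|\mathrm{grad}f\|_1^2=g_1(\mathrm{grad}f,\mathrm{grad}f)$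 and $H^f(Y_1,Z_1)=g_1(\nabla^1_{Y_1}\mathrm{grad}f,Z_1)$. Denote a vector field on $M_i$ and its lift to $M$ by the same letter. Then for all smooth vector fields $X_i,Y_i,Z_i\in\mathfrak X(M_i)$, $i=1,2$, at every point of $M$: $$\mathcal C(X_1,Y_1)Z_1=\mathcal R^1(X_1,Y_1)Z_1-\frac{\tau}{n(n-1)}\,[\,g_1(X_1,Z_1)Y_1-g_1(Y_1,Z_1)X_1\,],$$ $$\mathcal C(X_2,Y_1)Z_1=\Big[\frac1f H^f(Y_1,Z_1)+\frac{\tau}{n(n-1)}\,g_1(Y_1,Z_1)\Big]X_2,$$ $$\mathcal C(X_1,Y_2)Z_2=f\,g_2(Y_2,Z_2)\Big[\nabla^1_{X_1}\mathrm{grad}f+\frac{\tau f}{n(n-1)}X_1\Big],$$ $$\mathcal C(X_2,Y_2)Z_2=\mathcal R^2(X_2,Y_2)Z_2-\Big(\|\mathrm{grad}f\|_1^2+\frac{\tau f^2}{n(n-1)}\Big)[\,g_2(X_2,Z_2)Y_2-g_2(Y_2,Z_2)X_2\,].$$ For the remaining combinations of arguments, $\mathcal C(X_1,Y_1)Z_2=0$,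 $\mathcal C(X_2,Y_2)Z_1=0$, $\mathcal C(Y_1,X_2)Z_1=-\mathcal C(X_2,Y_1)Z_1$ and $\mathcal C(Y_2,X_1)Z_2=-\mathcal C(X_1,Y_2)Z_2$. -/

import Mathlib

open Bundle FiberBundle VectorField
open scoped Manifold ContDiff Bundle

noncomputable section

section Metric

variable {E : Type*} [NormedAddCommGroup E] [NormedSpace ℝ E]
  {H : Type*} [TopologicalSpace H] (I : ModelWithCorners ℝ E H)
  (M : Type*) [TopologicalSpace M] [ChartedSpace H M] [IsManifold I ∞ M]

/-- A smooth pseudo-Riemannian metric on `M`: a smooth symmetric nondegenerate `(0,2)`-tensor field.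
(Its index is locally constant; no assumption on the signature is made.) -/
structure PseudoRiemannianMetric where
  val (x : M) : TangentSpace I x →L[ℝ] TangentSpace I x →L[ℝ] ℝ
  symm (x : M) (v w : TangentSpace I x) : val x v w = val x w v
  nondegenerate (x : M) (v : TangentSpace I x) (hv : ∀ w, val x v w = 0) : v = 0
  contMDiff : ContMDiff I (I.prod 𝓘(ℝ, E →L[ℝ] E →L[ℝ] ℝ)) ∞
    (fun x ↦ TotalSpace.mk' (E →L[ℝ] E →L[ℝ] ℝ) x (val x))

end Metric

namespace PseudoRiemannianMetric

variable {E : Type*} [NormedAddCommGroup E] [NormedSpace ℝ E]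
  {H : Type*} [TopologicalSpace H] {I : ModelWithCorners ℝ E H}
  {M : Type*} [TopologicalSpace M] [ChartedSpace H M] [IsManifold I ∞ M]
  (g : PseudoRiemannianMetric I M)

/-- The function `g(X, Y)`. -/
def inner (X Y : Π x : M, TangentSpace I x) : M → ℝ := fun x ↦ g.val x (X x) (Y x)

lemma mdifferentiableAt_inner {X Y : Π x : M, TangentSpace I x} {x : M}
    (hX : MDiffAt (T% X) x) (hY : MDiffAt (T% Y) x) : MDiffAt (g.inner X Y) x := by
  have h : MDifferentiableAt I (I.prod 𝓘(ℝ))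
      (fun m ↦ TotalSpace.mk' ℝ (E := Bundle.Trivial M ℝ) m (g.val m (X m) (Y m))) x := by
    rw [← mdifferentiableWithinAt_univ] at hX hY ⊢
    apply MDifferentiableWithinAt.clm_bundle_apply₂ (F₁ := E) (F₂ := E)
    · exact (g.contMDiff.contMDiffAt.mdifferentiableAt (by simp)).mdifferentiableWithinAt
    · exact hX
    · exact hY
  simp only [mdifferentiableAt_totalSpace] at h
  exact h.2

/-- The right-hand side of the Koszul formula,
`X g(Y,Z) + Y g(Z,X) - Z g(X,Y) - g(X,[Y,Z]) + g(Y,[Z,X]) + g(Z,[X,Y])`. -/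
def koszul (X Y Z : Π x : M, TangentSpace I x) (x : M) : ℝ :=
  mvfderiv I (g.inner Y Z) x (X x) + mvfderiv I (g.inner Z X) x (Y x)
    - mvfderiv I (g.inner X Y) x (Z x)
    - g.val x (X x) (mlieBracket I Y Z x) + g.val x (Y x) (mlieBracket I Z X x)
    + g.val x (Z x) (mlieBracket I X Y x)

lemma inner_add_left (X X' Y : Π x : M, TangentSpace I x) : g.inner (X + X') Y = g.inner X Y + g.inner X' Y := by
  ext; simp [inner]
lemma inner_add_right (X Y Y' : Π x : M, TangentSpace I x) : g.inner X (Y + Y') = g.inner X Y + g.inner X Y' := by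
  ext; simp [inner]
lemma inner_smul_left (f : M → ℝ) (X Y : Π x : M, TangentSpace I x) : g.inner (f • X) Y = f * g.inner X Y := by
  ext; simp [inner]
lemma inner_smul_right (f : M → ℝ) (X Y : Π x : M, TangentSpace I x) : g.inner X (f • Y) = f * g.inner X Y := by
  ext; simp [inner]
lemma inner_comm (X Y : Π x : M, TangentSpace I x) : g.inner X Y = g.inner Y X := by
  ext x; exact g.symm x _ _

variable [FiniteDimensional ℝ E]

instance (x : M) : FiniteDimensional ℝ (TangentSpace I x) := inferInstanceAs (FiniteDimensional ℝ E)
instance (x : M) : T2Space (TangentSpace I x) := inferInstanceAs (T2Space E)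

lemma koszul_tensorial_left {Y Z : Π x : M, TangentSpace I x} {x : M}
    (hY : MDiffAt (T% Y) x) (hZ : MDiffAt (T% Z) x) :
    TensorialAt I E (fun X ↦ g.koszul X Y Z x) x where
  smul {f X} hf hX := by
    have h1 := g.mdifferentiableAt_inner hZ hX
    have h2 := g.mdifferentiableAt_inner hX hY
    simp only [koszul, inner_smul_left, inner_smul_right, mlieBracket_smul_right hf hX,
      mlieBracket_smul_left hf hX, mvfderiv_mul hf h1, mvfderiv_mul hf h2]
    simp [inner, g.symm x (Z x) (X x), g.symm x (Y x) (X x)]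
    ring
  add {X X'} hX hX' := by
    have h1 := g.mdifferentiableAt_inner hZ hX
    have h2 := g.mdifferentiableAt_inner hX hY
    have h1' := g.mdifferentiableAt_inner hZ hX'
    have h2' := g.mdifferentiableAt_inner hX' hY
    simp only [koszul, inner_add_left, inner_add_right, mlieBracket_add_right hX hX',
      mlieBracket_add_left hX hX', mvfderiv_add h1 h1', mvfderiv_add h2 h2']
    simp
    ring

lemma koszul_tensorial_right {X Y : Π x : M, TangentSpace I x} {x : M}
    (hX : MDiffAt (T% X) x) (hY : MDiffAt (T% Y) x) :
    TensorialAt I E (fun Z ↦ g.koszul X Y Z x) x where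
  smul {f Z} hf hZ := by
    have h1 := g.mdifferentiableAt_inner hY hZ
    have h2 := g.mdifferentiableAt_inner hZ hX
    simp only [koszul, inner_smul_left, inner_smul_right, mlieBracket_smul_right hf hZ,
      mlieBracket_smul_left hf hZ, mvfderiv_mul hf h1, mvfderiv_mul hf h2]
    simp [inner, g.symm x (Z x) (X x)]
    ring
  add {Z Z'} hZ hZ' := by
    have h1 := g.mdifferentiableAt_inner hY hZ
    have h2 := g.mdifferentiableAt_inner hZ hX
    have h1' := g.mdifferentiableAt_inner hY hZ'
    have h2' := g.mdifferentiableAt_inner hZ' hX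
    simp only [koszul, inner_add_left, inner_add_right, mlieBracket_add_right hZ hZ',
      mlieBracket_add_left hZ hZ', mvfderiv_add h1 h1', mvfderiv_add h2 h2']
    simp
    ring

lemma koszul_add {X Y Y' Z : Π x : M, TangentSpace I x} {x : M}
    (hX : MDiffAt (T% X) x) (hY : MDiffAt (T% Y) x) (hY' : MDiffAt (T% Y') x)
    (hZ : MDiffAt (T% Z) x) :
    g.koszul X (Y + Y') Z x = g.koszul X Y Z x + g.koszul X Y' Z x := by
  have h1 := g.mdifferentiableAt_inner hY hZ
  have h2 := g.mdifferentiableAt_inner hX hY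
  have h1' := g.mdifferentiableAt_inner hY' hZ
  have h2' := g.mdifferentiableAt_inner hX hY'
  simp only [koszul, inner_add_left, inner_add_right, mlieBracket_add_right hY hY',
    mlieBracket_add_left hY hY', mvfderiv_add h1 h1', mvfderiv_add h2 h2']
  simp
  ring

lemma koszul_smul {X Y Z : Π x : M, TangentSpace I x} {f : M → ℝ} {x : M}
    (hX : MDiffAt (T% X) x) (hY : MDiffAt (T% Y) x) (hf : MDiffAt f x)
    (hZ : MDiffAt (T% Z) x) :
    g.koszul X (f • Y) Z x
      = f x * g.koszul X Y Z x + 2 * (mvfderiv I f x (X x) * g.val x (Y x) (Z x)) := by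
  have h1 := g.mdifferentiableAt_inner hY hZ
  have h2 := g.mdifferentiableAt_inner hX hY
  simp only [koszul, inner_smul_left, inner_smul_right, mlieBracket_smul_right hf hY,
    mlieBracket_smul_left hf hY, mvfderiv_mul hf h1, mvfderiv_mul hf h2]
  simp [inner, g.symm x (Z x) (Y x)]
  ring

lemma flat_injective (x : M) :
    Function.Injective ((g.val x : TangentSpace I x →ₗ[ℝ] (TangentSpace I x →L[ℝ] ℝ))) := by
  rw [← LinearMap.ker_eq_bot, LinearMap.ker_eq_bot']
  intro v hv
  exact g.nondegenerate x v fun w ↦ by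
    simpa using congrArg (fun φ : TangentSpace I x →L[ℝ] ℝ ↦ φ w) hv

/-- The musical isomorphism `v ↦ g(v, ·)` from tangent vectors to covectors. -/
def flat (x : M) : TangentSpace I x ≃L[ℝ] (TangentSpace I x →L[ℝ] ℝ) :=
  (LinearEquiv.ofInjectiveOfFinrankEq _ (g.flat_injective x) (by
    rw [← (LinearMap.toContinuousLinearMap : (TangentSpace I x →ₗ[ℝ] ℝ) ≃ₗ[ℝ] _).finrank_eq]
    exact Subspace.dual_finrank_eq.symm)).toContinuousLinearEquiv


lemma flat_apply (x : M) (v w : TangentSpace I x) : g.flat x v w = g.val x v w := rfl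

lemma val_flat_symm (x : M) (φ : TangentSpace I x →L[ℝ] ℝ) (w : TangentSpace I x) :
    g.val x ((g.flat x).symm φ) w = φ w := by
  rw [← flat_apply, ContinuousLinearEquiv.apply_symm_apply]

open scoped Classical in
/-- For `Y` differentiable at `x`, the bilinear form `(X, Z) ↦ koszul X Y Z` on the tangent space
at `x`. -/
def koszulForm (Y : Π x : M, TangentSpace I x) (x : M) :
    TangentSpace I x →L[ℝ] TangentSpace I x →L[ℝ] ℝ :=
  if hY : MDiffAt (T% Y) x then
    TensorialAt.mkHom₂ (fun X Z ↦ g.koszul X Y Z x) x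
      (fun _ hZ ↦ g.koszul_tensorial_left hY hZ)
      (fun _ hX ↦ g.koszul_tensorial_right hX hY)
  else 0

lemma koszulForm_apply {X Y Z : Π x : M, TangentSpace I x} {x : M}
    (hX : MDiffAt (T% X) x) (hY : MDiffAt (T% Y) x) (hZ : MDiffAt (T% Z) x) :
    g.koszulForm Y x (X x) (Z x) = g.koszul X Y Z x := by
  rw [koszulForm, dif_pos hY]
  exact TensorialAt.mkHom₂_apply _ _ hX hZ

/-- The Levi-Civita connection of `g`, defined by the Koszul formula
`2 g(∇_X Y, Z) = koszul X Y Z`. Here `g.leviCivita Y x (X x)` is `(∇_X Y)(x)`. -/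
def leviCivita : CovariantDerivative I E (TangentSpace I : M → Type _) where
  toFun Y x := (1 / 2 : ℝ) • ((g.flat x).symm : _ →L[ℝ] TangentSpace I x) ∘L g.koszulForm Y x
  isCovariantDerivativeOnUniv :=
    { add := by
        intro Y Y' x hY hY' _
        rw [← smul_add, ← ContinuousLinearMap.comp_add]
        congr 2
        ext v w
        have hv := mdifferentiableAt_extend I E v
        have hw := mdifferentiableAt_extend I E w
        have h1 := g.koszulForm_apply hv hY hw
        have h2 := g.koszulForm_apply hv hY' hw
        have h3 := g.koszulForm_apply hv (mdifferentiableAt_add_section hY hY') hw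
        rw [g.koszul_add hv hY hY' hw, ← h1, ← h2] at h3
        simpa using h3
      leibniz := by
        intro Y f x hY hf _
        ext v
        apply (g.flat x).injective
        ext w
        have hv := mdifferentiableAt_extend I E v
        have hw := mdifferentiableAt_extend I E w
        have h1 := g.koszulForm_apply hv hY hw
        have h3 := g.koszulForm_apply hv (hf.smul_section hY) hw
        rw [g.koszul_smul hv hY hf hw, ← h1] at h3
        simp only [extend_apply_self] at h3
        simp [h3, flat_apply]
        ring }

theorem two_mul_val_leviCivita {X Y Z : Π x : M, TangentSpace I x} {x : M}
    (hX : MDiffAt (T% X) x) (hY : MDiffAt (T% Y) x) (hZ : MDiffAt (T% Z) x) :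
    2 * g.val x (g.leviCivita Y x (X x)) (Z x) = g.koszul X Y Z x := by
  rw [← g.koszulForm_apply hX hY hZ]
  simp [leviCivita, val_flat_symm]

/-- The Levi-Civita connection is torsion free. -/
theorem leviCivita_torsion : g.leviCivita.torsion = 0 := by
  rw [CovariantDerivative.torsion_eq_zero_iff]
  intro X Y x hX hY
  apply (g.flat x).injective
  ext w
  have hw := mdifferentiableAt_extend I E w
  have h1 := g.two_mul_val_leviCivita hX hY hw
  have h2 := g.two_mul_val_leviCivita hY hX hw
  simp only [extend_apply_self, koszul] at h1 h2
  rw [inner_comm g Y X, mlieBracket_swap_apply (V := Y) (W := X),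
    mlieBracket_swap_apply (V := X) (W := extend E w),
    mlieBracket_swap_apply (V := extend E w) (W := Y), inner_comm g _ Y, inner_comm g X] at h2
  simp only [map_neg] at h2
  rw [map_sub, sub_apply, flat_apply, flat_apply, flat_apply]
  rw [g.symm x (mlieBracket I X Y x) w]
  linarith

/-- The Levi-Civita connection is compatible with the metric. -/
theorem leviCivita_metric {X Y Z : Π x : M, TangentSpace I x} {x : M}
    (hX : MDiffAt (T% X) x) (hY : MDiffAt (T% Y) x) (hZ : MDiffAt (T% Z) x) :
    mvfderiv I (g.inner Y Z) x (X x)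
      = g.val x (g.leviCivita Y x (X x)) (Z x) + g.val x (Y x) (g.leviCivita Z x (X x)) := by
  have h1 := g.two_mul_val_leviCivita hX hY hZ
  have h2 := g.two_mul_val_leviCivita hX hZ hY
  simp only [koszul] at h1 h2
  rw [inner_comm g Z Y, mlieBracket_swap_apply (V := Z) (W := Y),
    mlieBracket_swap_apply (V := Y) (W := X),
    mlieBracket_swap_apply (V := X) (W := Z), inner_comm g Y X,
    inner_comm g X Z] at h2
  simp only [map_neg] at h2
  rw [g.symm x (Y x)]
  linarith

/-- The covariant derivative `∇_X Y` as a vector field. -/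
def nabla (X Y : Π x : M, TangentSpace I x) : Π x : M, TangentSpace I x :=
  fun x ↦ g.leviCivita Y x (X x)

/-- The Riemann curvature tensor, with the sign convention
`R(X,Y)Z = ∇_Y ∇_X Z - ∇_X ∇_Y Z + ∇_[X,Y] Z`. -/
def curvature (X Y Z : Π x : M, TangentSpace I x) : Π x : M, TangentSpace I x :=
  g.nabla Y (g.nabla X Z) - g.nabla X (g.nabla Y Z) + g.nabla (mlieBracket I X Y) Z

/-- The value `R(u,v)w` of the curvature tensor on tangent vectors at `x`, computed by extending
`u`, `v`, `w` to vector fields with constant coefficients in the chart at `x`. -/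
def curvatureAt (x : M) (u v w : TangentSpace I x) : TangentSpace I x :=
  g.curvature (extend E u) (extend E v) (extend E w) x

/-- The Ricci tensor `Ric(u,w) = trace (v ↦ R(u,v)w)`, which with the above sign convention for the
curvature is positive on round spheres. -/
def ricci (x : M) (u w : TangentSpace I x) : ℝ :=
  let b := Module.finBasis ℝ (TangentSpace I x)
  ∑ k, b.coord k (g.curvatureAt x u (b k) w)

/-- The scalar curvature `τ = g^{ij} Ric_{ij}`. -/
def scalarCurvature (x : M) : ℝ :=
  let b := Module.finBasis ℝ (TangentSpace I x)
  let G : Matrix (Fin _) (Fin _) ℝ := Matrix.of fun i j ↦ g.val x (b i) (b j)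
  ∑ i, ∑ j, G⁻¹ i j * g.ricci x (b i) (b j)

/-- The concircular curvature tensor
`C(X,Y)Z = R(X,Y)Z - τ / (n (n - 1)) • [g(X,Z) Y - g(Y,Z) X]`, with `n = dim M`. -/
def concircular (X Y Z : Π x : M, TangentSpace I x) : Π x : M, TangentSpace I x :=
  fun x ↦ g.curvature X Y Z x
    - (g.scalarCurvature x / ((Module.finrank ℝ E : ℝ) * ((Module.finrank ℝ E : ℝ) - 1))) •
      (g.inner X Z x • Y x - g.inner Y Z x • X x)

/-- The gradient of `f`: `g(grad f, ·) = df`. -/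
def gradient (f : M → ℝ) : Π x : M, TangentSpace I x :=
  fun x ↦ (g.flat x).symm (mvfderiv I f x)

/-- The Hessian `H^f(Y,Z) = g(∇_Y grad f, Z)`. -/
def hessian (f : M → ℝ) (Y Z : Π x : M, TangentSpace I x) : M → ℝ :=
  g.inner (g.nabla Y (g.gradient f)) Z

end PseudoRiemannianMetric

section Pullback
variable {E : Type*} [NormedAddCommGroup E] [NormedSpace ℝ E]
  {H : Type*} [TopologicalSpace H] {I : ModelWithCorners ℝ E H}
  {M : Type*} [TopologicalSpace M] [ChartedSpace H M] [IsManifold I ∞ M]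
  {E' : Type*} [NormedAddCommGroup E'] [NormedSpace ℝ E']
  {H' : Type*} [TopologicalSpace H'] {I' : ModelWithCorners ℝ E' H'}
  {N : Type*} [TopologicalSpace N] [ChartedSpace H' N] [IsManifold I' ∞ N]

variable (I I') in
/-- The pull-back `φ^* b` of a field `b` of bilinear forms on the tangent spaces. -/
def pullbackForm (φ : M → N) (b : Π y : N, TangentSpace I' y →L[ℝ] TangentSpace I' y →L[ℝ] ℝ)
    (x : M) : TangentSpace I x →L[ℝ] TangentSpace I x →L[ℝ] ℝ :=
  (mfderiv I I' φ x).precomp ℝ ∘L b (φ x) ∘L mfderiv I I' φ x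

lemma pullbackForm_apply (φ : M → N)
    (b : Π y : N, TangentSpace I' y →L[ℝ] TangentSpace I' y →L[ℝ] ℝ) (x : M)
    (v w : TangentSpace I x) :
    pullbackForm I I' φ b x v w = b (φ x) (mfderiv I I' φ x v) (mfderiv I I' φ x w) := rfl

lemma contMDiffAt_precomp_comp {D : M → E →L[ℝ] E'} {G : M → E' →L[ℝ] E' →L[ℝ] ℝ} {x₀ : M}
    (hD : ContMDiffAt I 𝓘(ℝ, E →L[ℝ] E') ∞ D x₀)
    (hG : ContMDiffAt I 𝓘(ℝ, E' →L[ℝ] E' →L[ℝ] ℝ) ∞ G x₀) :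
    ContMDiffAt I 𝓘(ℝ, E →L[ℝ] E →L[ℝ] ℝ) ∞ (fun x ↦ (D x).precomp ℝ ∘L G x ∘L D x) x₀ :=
  by
  have h1 : ContMDiffAt I 𝓘(ℝ, (E' →L[ℝ] ℝ) →L[ℝ] (E →L[ℝ] ℝ)) ∞
      (fun x ↦ (D x).precomp ℝ) x₀ := ContMDiffAt.clm_precomp (F₃ := ℝ) hD
  have h2 : ContMDiffAt I 𝓘(ℝ, E →L[ℝ] (E' →L[ℝ] ℝ)) ∞ (fun x ↦ G x ∘L D x) x₀ :=
    ContMDiffAt.clm_comp hG hD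
  exact ContMDiffAt.clm_comp h1 h2

lemma exists_mfderiv_coordinates {φ : M → N} (hφ : ContMDiff I I' ∞ φ) (x₀ : M) :
    ∃ D : M → E →L[ℝ] E', ContMDiffAt I 𝓘(ℝ, E →L[ℝ] E') ∞ D x₀ ∧ ∀ᶠ x in nhds x₀, ∀ v,
      (trivializationAt E' (TangentSpace I' : N → Type _) (φ x₀)).symm (φ x) (D x v) =
        mfderiv I I' φ x ((trivializationAt E (TangentSpace I : M → Type _) x₀).symm x v) := by
  refine ⟨fun x ↦ ContinuousLinearMap.inCoordinates E (TangentSpace I : M → Type _) E'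
    (TangentSpace I' : N → Type _) x₀ x (φ x₀) (φ x) (mfderiv I I' φ x),
    (hφ x₀).mfderiv_const (m := ∞) (by simp), ?_⟩
  have h1 : ∀ᶠ x in nhds x₀, x ∈ (trivializationAt E (TangentSpace I : M → Type _) x₀).baseSet :=
    (trivializationAt E (TangentSpace I : M → Type _) x₀).open_baseSet.mem_nhds
      (FiberBundle.mem_baseSet_trivializationAt' x₀)
  have h2 : ∀ᶠ x in nhds x₀,
      φ x ∈ (trivializationAt E' (TangentSpace I' : N → Type _) (φ x₀)).baseSet :=
    (hφ x₀).continuousAt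
      ((trivializationAt E' (TangentSpace I' : N → Type _) (φ x₀)).open_baseSet.mem_nhds
        (FiberBundle.mem_baseSet_trivializationAt' (φ x₀)))
  filter_upwards [h1, h2] with x hx hφx v
  rw [ContinuousLinearMap.inCoordinates_eq hx hφx]
  simp only [ContinuousLinearMap.comp_apply, ContinuousLinearEquiv.coe_coe,
    Trivialization.coe_continuousLinearEquivAt_eq, Trivialization.symm_continuousLinearEquivAt_eq,
    Trivialization.continuousLinearMapAt_apply, Trivialization.symm_linearMapAt _ hφx,
    Trivialization.symmL_apply _ hx]

lemma exists_form_coordinates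
    {b : Π y : N, TangentSpace I' y →L[ℝ] TangentSpace I' y →L[ℝ] ℝ}
    (hb : ContMDiff I' (I'.prod 𝓘(ℝ, E' →L[ℝ] E' →L[ℝ] ℝ)) ∞
      (fun x ↦ TotalSpace.mk' (E' →L[ℝ] E' →L[ℝ] ℝ) x (b x))) (y₀ : N) :
    ∃ G : N → E' →L[ℝ] E' →L[ℝ] ℝ, ContMDiffAt I' 𝓘(ℝ, E' →L[ℝ] E' →L[ℝ] ℝ) ∞ G y₀ ∧
      ∀ᶠ y in nhds y₀, ∀ v w, G y v w =
        b y ((trivializationAt E' (TangentSpace I' : N → Type _) y₀).symm y v)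
          ((trivializationAt E' (TangentSpace I' : N → Type _) y₀).symm y w) := by
  refine ⟨_, ((contMDiffAt_hom_bundle _).1 (hb y₀)).2, ?_⟩
  filter_upwards [(trivializationAt E' (TangentSpace I' : N → Type _) y₀).open_baseSet.mem_nhds
      (FiberBundle.mem_baseSet_trivializationAt' y₀)] with y hy v w
  rw [inCoordinates_apply_eq₂ hy hy (Set.mem_univ _)]
  simp

lemma contMDiff_pullbackForm {φ : M → N} (hφ : ContMDiff I I' ∞ φ)
    {b : Π y : N, TangentSpace I' y →L[ℝ] TangentSpace I' y →L[ℝ] ℝ}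
    (hb : ContMDiff I' (I'.prod 𝓘(ℝ, E' →L[ℝ] E' →L[ℝ] ℝ)) ∞
      (fun x ↦ TotalSpace.mk' (E' →L[ℝ] E' →L[ℝ] ℝ) x (b x))) :
    ContMDiff I (I.prod 𝓘(ℝ, E →L[ℝ] E →L[ℝ] ℝ)) ∞
      (fun x ↦ TotalSpace.mk' (E →L[ℝ] E →L[ℝ] ℝ) x (pullbackForm I I' φ b x)) := by
  intro x₀
  rw [contMDiffAt_hom_bundle]
  refine ⟨contMDiffAt_id, ?_⟩
  obtain ⟨D, hD, hDx⟩ := exists_mfderiv_coordinates hφ x₀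
  obtain ⟨G, hG, hGx⟩ := exists_form_coordinates hb (φ x₀)
  refine (contMDiffAt_precomp_comp hD (hG.comp x₀ (hφ x₀))).congr_of_eventuallyEq ?_
  filter_upwards [hDx, (hφ x₀).continuousAt.eventually hGx,
    (trivializationAt E (TangentSpace I : M → Type _) x₀).open_baseSet.mem_nhds
      (FiberBundle.mem_baseSet_trivializationAt' x₀)] with x h1 h2 hx
  ext v w
  rw [inCoordinates_apply_eq₂ hx hx (Set.mem_univ _), pullbackForm_apply]
  simp only [ContinuousLinearMap.comp_apply, ContinuousLinearMap.precomp_apply, Function.comp_apply]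
  rw [h2, h1, h1]
  simp

end Pullback

section Warped
variable {E₁ : Type*} [NormedAddCommGroup E₁] [NormedSpace ℝ E₁]
  {H₁ : Type*} [TopologicalSpace H₁] {I₁ : ModelWithCorners ℝ E₁ H₁}
  {M₁ : Type*} [TopologicalSpace M₁] [ChartedSpace H₁ M₁] [IsManifold I₁ ∞ M₁]
  {E₂ : Type*} [NormedAddCommGroup E₂] [NormedSpace ℝ E₂]
  {H₂ : Type*} [TopologicalSpace H₂] {I₂ : ModelWithCorners ℝ E₂ H₂}
  {M₂ : Type*} [TopologicalSpace M₂] [ChartedSpace H₂ M₂] [IsManifold I₂ ∞ M₂]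

variable (I₁ I₂ M₂) in
/-- The lift of a vector field on `M₁` to `M₁ × M₂`: its value at `(p, q)` is the image of `X p`
under the differential of the inclusion of the leaf `M₁ × {q}`. -/
def liftLeft (X : Π p : M₁, TangentSpace I₁ p) :
    Π z : M₁ × M₂, TangentSpace (I₁.prod I₂) z :=
  fun z ↦ mfderiv I₁ (I₁.prod I₂) (fun p : M₁ ↦ (p, z.2)) z.1 (X z.1)

variable (I₁ I₂ M₁) in
/-- The lift of a vector field on `M₂` to `M₁ × M₂`: its value at `(p, q)` is the image of `X q`
under the differential of the inclusion of the fibre `{p} × M₂`. -/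
def liftRight (X : Π q : M₂, TangentSpace I₂ q) :
    Π z : M₁ × M₂, TangentSpace (I₁.prod I₂) z :=
  fun z ↦ mfderiv I₂ (I₁.prod I₂) (fun q : M₂ ↦ (z.1, q)) z.2 (X z.2)

/-- The warped product metric `π₁^* g₁ + (f ∘ π₁)² π₂^* g₂` on `M₁ × M₂`. -/
def warpedProductMetric (g₁ : PseudoRiemannianMetric I₁ M₁) (g₂ : PseudoRiemannianMetric I₂ M₂)
    (f : M₁ → ℝ) (hf : ContMDiff I₁ 𝓘(ℝ) ∞ f) (hpos : ∀ p, 0 < f p) :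
    PseudoRiemannianMetric (I₁.prod I₂) (M₁ × M₂) where
  val z := pullbackForm (I₁.prod I₂) I₁ Prod.fst g₁.val z +
    f z.1 ^ 2 • pullbackForm (I₁.prod I₂) I₂ Prod.snd g₂.val z
  symm z v w := by
    simp only [add_apply, smul_apply, pullbackForm_apply]
    rw [g₁.symm, g₂.symm]
  nondegenerate z v hv := by
    have key (w : TangentSpace (I₁.prod I₂) z) :
      g₁.val z.1 v.1 w.1 + f z.1 ^ 2 * g₂.val z.2 v.2 w.2 = 0 := by
      have := hv w
      simp only [add_apply, smul_apply, pullbackForm_apply, mfderiv_fst, mfderiv_snd] at this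
      exact this
    have h1 : v.1 = (0 : E₁) := g₁.nondegenerate z.1 v.1 fun w ↦ by
      have h := key (w, (0 : E₂))
      have e : g₂.val z.2 v.2 (0 : E₂) = 0 := map_zero (g₂.val z.2 v.2)
      linear_combination h - f z.1 ^ 2 * e
    have h2 : v.2 = (0 : E₂) := g₂.nondegenerate z.2 v.2 fun w ↦ by
      have h := key ((0 : E₁), w)
      have e : g₁.val z.1 v.1 (0 : E₁) = 0 := map_zero (g₁.val z.1 v.1)
      have h' : f z.1 ^ 2 * g₂.val z.2 v.2 w = 0 := by linear_combination h - e
      exact (mul_eq_zero.1 h').resolve_left (pow_ne_zero 2 (hpos z.1).ne')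
    exact Prod.ext h1 h2
  contMDiff := by
    have h1 := contMDiff_pullbackForm (I := I₁.prod I₂) (I' := I₁)
      (φ := (Prod.fst : M₁ × M₂ → M₁)) contMDiff_fst g₁.contMDiff
    have h2 := contMDiff_pullbackForm (I := I₁.prod I₂) (I' := I₂)
      (φ := (Prod.snd : M₁ × M₂ → M₂)) contMDiff_snd g₂.contMDiff
    have hf' : ContMDiff (I₁.prod I₂) 𝓘(ℝ) ∞ (fun z : M₁ × M₂ ↦ f z.1 ^ 2) :=
      (hf.comp contMDiff_fst).pow 2
    exact h1.add_section (hf'.smul_section h2)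

end Warped

/-- The space `𝔛(M)` of smooth vector fields on `M`. -/
abbrev SmoothVectorField {E : Type*} [NormedAddCommGroup E] [NormedSpace ℝ E]
    {H : Type*} [TopologicalSpace H] (I : ModelWithCorners ℝ E H)
    (M : Type*) [TopologicalSpace M] [ChartedSpace H M] [IsManifold I ∞ M] :=
  ContMDiffSection I E ∞ (TangentSpace I : M → Type _)

end

section RelatedFields

variable {E : Type*} [NormedAddCommGroup E] [NormedSpace ℝ E]
  {H : Type*} [TopologicalSpace H] {I : ModelWithCorners ℝ E H}
  {M : Type*} [TopologicalSpace M] [ChartedSpace H M]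
  {F : Type*} [NormedAddCommGroup F] [NormedSpace ℝ F]

lemma mvfderiv_apply_eq_fderivWithin {u : M → F} {x : M} (hu : MDiffAt u x)
    (v : TangentSpace I x) :
    mvfderiv I u x v =
      fderivWithin ℝ (u ∘ (extChartAt I x).symm) (Set.range I) (extChartAt I x x) v := by
  have h : mfderiv I 𝓘(ℝ, F) u x =
      (fderivWithin ℝ (u ∘ (extChartAt I x).symm) (Set.range I) (extChartAt I x x) :) := if_pos hu
  exact congrArg (fun A : E →L[ℝ] F ↦ A v) h

lemma mvfderiv_congr {u u' : M → F} {x : M} (h : u =ᶠ[nhds x] u') (v : TangentSpace I x) :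
    mvfderiv I u x v = mvfderiv I u' x v := by
  change (mfderiv I 𝓘(ℝ, F) u x) v = (mfderiv I 𝓘(ℝ, F) u' x) v
  exact congrArg (fun A : E →L[ℝ] F ↦ A v) h.mfderiv_eq

lemma mvfderiv_sq {f : M → ℝ} {p : M} (h : MDiffAt f p) (v : TangentSpace I p) :
    mvfderiv I (fun p ↦ f p ^ 2) p v = 2 * f p * mvfderiv I f p v := by
  have : (fun p ↦ f p ^ 2) = f * f := by ext; simp [sq]
  rw [this, mvfderiv_mul h h]
  simp
  ring

variable [IsManifold I ∞ M]

/-- The derivative of a smooth function along a smooth vector field is smooth. -/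
lemma contMDiffAt_mvfderiv_apply {u : M → F} {W : Π x : M, TangentSpace I x} {x : M}
    (hu : ContMDiffAt I 𝓘(ℝ, F) ∞ u x) (hW : ContMDiffAt I I.tangent ∞ (T% W) x) :
    ContMDiffAt I 𝓘(ℝ, F) ∞ (fun y ↦ mvfderiv I u y (W y)) x := by
  have h1 : ContMDiffAt I (𝓘(ℝ, F).tangent) ∞ (fun m ↦ (mfderiv I 𝓘(ℝ, F) u m (W m) :
      TotalSpace F (TangentSpace 𝓘(ℝ, F) : F → Type _))) x :=
    ContMDiffAt.clm_apply_of_inCoordinates (hu.mfderiv_const (m := ∞) (by simp)) hW hu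
  exact (contMDiff_snd_tangentBundle_modelSpace F 𝓘(ℝ, F)).contMDiffAt.comp x h1

lemma mdifferentiableAt_mvfderiv_apply {u : M → F} {W : Π x : M, TangentSpace I x} {x : M}
    (hu : ContMDiffAt I 𝓘(ℝ, F) ∞ u x) (hW : MDiffAt (T% W) x) :
    MDiffAt (fun y ↦ mvfderiv I u y (W y)) x := by
  have h1 : MDifferentiableAt I (𝓘(ℝ, F).tangent) (fun m ↦ (mfderiv I 𝓘(ℝ, F) u m (W m) :
      TotalSpace F (TangentSpace 𝓘(ℝ, F) : F → Type _))) x :=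
    MDifferentiableAt.clm_apply_of_inCoordinates
      ((hu.mfderiv_const (m := ∞) (by simp)).mdifferentiableAt (by simp)) hW
      (hu.mdifferentiableAt (by simp))
  exact ((contMDiff_snd_tangentBundle_modelSpace F 𝓘(ℝ, F) (n := ∞)).contMDiffAt.mdifferentiableAt
    (by simp)).comp x h1

variable [CompleteSpace E]

/-- The derivative along `[V, W]` is the commutator of the derivatives along `V` and `W`. -/
theorem mvfderiv_mlieBracket {u : M → F} {V W : Π x : M, TangentSpace I x} {x : M}
    (hu : ContMDiffAt I 𝓘(ℝ, F) ∞ u x) (hV : MDiffAt (T% V) x) (hW : MDiffAt (T% W) x) :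
    mvfderiv I u x (mlieBracket I V W x) =
      mvfderiv I (fun y ↦ mvfderiv I u y (W y)) x (V x) -
        mvfderiv I (fun y ↦ mvfderiv I u y (V y)) x (W x) := by
  have : IsManifold I 2 M := IsManifold.of_le (n := ∞) ENat.LEInfty.out
  have : IsManifold I 1 M := IsManifold.of_le (n := ∞) (by exact_mod_cast le_top)
  set φ := extChartAt I x with hφ
  have hud : MDiffAt u x := hu.mdifferentiableAt (by simp)
  have hx0 : φ.symm (φ x) = x := extChartAt_to_inv x
  have hUc : ContDiffWithinAt ℝ 2 (u ∘ φ.symm) (Set.range I) (φ x) :=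
    ((contMDiffAt_iff.1 hu).2.of_le ENat.LEInfty.out)
  have hmem : φ x ∈ Set.range I := Set.mem_range_self _
  have hdiff {Y : Π x : M, TangentSpace I x} (hY : MDiffAt (T% Y) x) :
      DifferentiableWithinAt ℝ (mpullbackWithin 𝓘(ℝ, E) I φ.symm Y (Set.range I))
        (Set.range I) (φ x) := by
    have := MDifferentiableWithinAt.differentiableWithinAt_mpullbackWithin_vectorField
      (mdifferentiableWithinAt_univ.2 hY)
    rwa [Set.preimage_univ, Set.univ_inter] at this
  have hev {Y : Π x : M, TangentSpace I x} (hY : MDiffAt (T% Y) x) :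
      (fun y ↦ fderivWithin ℝ (u ∘ φ.symm) (Set.range I) y
        (mpullbackWithin 𝓘(ℝ, E) I φ.symm Y (Set.range I) y)) =ᶠ[nhdsWithin (φ x) (Set.range I)]
      (fun y ↦ mvfderiv I u y (Y y)) ∘ φ.symm := by
    have h2 : ∀ᶠ y in nhds x, MDiffAt u y := by
      filter_upwards [(contMDiffAt_iff_contMDiffAt_nhds (n := 1) (by simp)).1
        (hu.of_le (by exact_mod_cast le_top))] with y hy using hy.mdifferentiableAt (by simp)
    have h3 : ∀ᶠ y in nhdsWithin (φ x) (Set.range I), MDiffAt u (φ.symm y) := by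
      refine Filter.Tendsto.eventually ?_ h2
      have := (continuousAt_extChartAt_symm (I := I) x).tendsto
      rw [← hφ, hx0] at this
      exact this.mono_left nhdsWithin_le_nhds
    filter_upwards [h3, extChartAt_target_mem_nhdsWithin (I := I) x, self_mem_nhdsWithin]
      with y hy hyt hyr
    have hφd : MDifferentiableWithinAt 𝓘(ℝ, E) I φ.symm (Set.range I) y :=
      mdifferentiableWithinAt_extChartAt_symm hyt
    have hcomp := mfderiv_comp_mfderivWithin (I := 𝓘(ℝ, E)) (I' := I) (I'' := 𝓘(ℝ, F)) y hy hφd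
      (I.uniqueMDiffOn y hyr)
    rw [mfderivWithin_eq_fderivWithin] at hcomp
    have hinv := isInvertible_mfderivWithin_extChartAt_symm hyt
    rw [hcomp]
    change mfderiv I 𝓘(ℝ, F) u (φ.symm y) (mfderivWithin 𝓘(ℝ, E) I φ.symm (Set.range I) y
      ((mfderivWithin 𝓘(ℝ, E) I φ.symm (Set.range I) y).inverse (Y (φ.symm y)))) = _
    rw [hinv.self_apply_inverse]
    rfl
  have hval (Y : Π x : M, TangentSpace I x) :
      mpullbackWithin 𝓘(ℝ, E) I φ.symm Y (Set.range I) (φ x) = Y x := by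
    have h1 : ∀ z, z = x → ((ContinuousLinearMap.id ℝ E : E →L[ℝ] E) (Y z : E) : E) = Y x := by
      rintro _ rfl
      rfl
    have h2 := mfderivWithin_range_extChartAt_symm (I := I) (x := x)
    have h3 : (mfderivWithin 𝓘(ℝ, E) I φ.symm (Set.range I) (φ x)).inverse =
        (ContinuousLinearMap.id ℝ E : E →L[ℝ] E) := by
      refine (congrArg (ContinuousLinearMap.inverse (R := ℝ) (M := E) (M₂ := E)) h2).trans ?_
      exact ContinuousLinearMap.inverse_id
    refine (congrArg (fun A : E →L[ℝ] E ↦ A (Y (φ.symm (φ x)))) h3).trans (h1 _ hx0)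
  have key := fderivWithin_apply_lieBracket hUc (by simp) I.uniqueDiffOn
    (I.range_subset_closure_interior hmem) hmem (hdiff hW) (hdiff hV)
  rw [(hev hW).fderivWithin_eq ((hev hW).eq_of_nhdsWithin hmem),
    (hev hV).fderivWithin_eq ((hev hV).eq_of_nhdsWithin hmem), hval, hval] at key
  rw [mvfderiv_apply_eq_fderivWithin (mdifferentiableAt_mvfderiv_apply hu hW),
    mvfderiv_apply_eq_fderivWithin (mdifferentiableAt_mvfderiv_apply hu hV),
    mvfderiv_apply_eq_fderivWithin hud]
  have hb : mlieBracket I V W x = lieBracketWithin ℝ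
      (mpullbackWithin 𝓘(ℝ, E) I φ.symm V (Set.range I))
      (mpullbackWithin 𝓘(ℝ, E) I φ.symm W (Set.range I)) (Set.range I) (φ x) := by
    have h2 : (mfderiv I 𝓘(ℝ, E) φ x).inverse = (ContinuousLinearMap.id ℝ E : E →L[ℝ] E) := by
      refine (congrArg (ContinuousLinearMap.inverse (R := ℝ) (M := E) (M₂ := E))
        mfderiv_extChartAt_self).trans ?_
      exact ContinuousLinearMap.inverse_id
    rw [← mlieBracketWithin_univ, mlieBracketWithin_apply, Set.preimage_univ, Set.univ_inter]
    exact congrArg (fun A : E →L[ℝ] E ↦ A _) h2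
  rw [hb]
  exact key

variable {E' : Type*} [NormedAddCommGroup E'] [NormedSpace ℝ E'] [CompleteSpace E']
  {H' : Type*} [TopologicalSpace H'] {I' : ModelWithCorners ℝ E' H'}
  {N : Type*} [TopologicalSpace N] [ChartedSpace H' N] [IsManifold I' ∞ N]

/-- The Lie brackets of `φ`-related vector fields are `φ`-related. -/
theorem mfderiv_mlieBracket_of_related {φ : M → N} {V W : Π x : M, TangentSpace I x}
    {V' W' : Π y : N, TangentSpace I' y} {x : M} (hφ : ContMDiff I I' ∞ φ)
    (hV : MDiffAt (T% V) x) (hW : MDiffAt (T% W) x)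
    (hV' : MDiffAt (T% V') (φ x)) (hW' : MDiffAt (T% W') (φ x))
    (hVV : ∀ y, mfderiv I I' φ y (V y) = V' (φ y)) (hWW : ∀ y, mfderiv I I' φ y (W y) = W' (φ y)) :
    mfderiv I I' φ x (mlieBracket I V W x) = mlieBracket I' V' W' (φ x) := by
  have : IsManifold I' 1 N := IsManifold.of_le (n := ∞) (by exact_mod_cast le_top)
  set ψ := extChartAt I' (φ x)
  have hψ : ContMDiffAt I' 𝓘(ℝ, E') ∞ ψ (φ x) := contMDiffAt_extChartAt
  have hφd (y : M) : MDiffAt φ y := (hφ y).mdifferentiableAt (by simp)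
  have hev {Y : Π x : M, TangentSpace I x} {Y' : Π y : N, TangentSpace I' y}
      (h : ∀ y, mfderiv I I' φ y (Y y) = Y' (φ y)) :
      (fun y ↦ mvfderiv I (ψ ∘ φ) y (Y y)) =ᶠ[nhds x]
        (fun y ↦ mvfderiv I' ψ y (Y' y)) ∘ φ := by
    have h1 : ∀ᶠ y in nhds (φ x), MDiffAt ψ y := by
      filter_upwards [(contMDiffAt_iff_contMDiffAt_nhds (n := 1) (by simp)).1
        (hψ.of_le (by exact_mod_cast le_top))] with y hy using hy.mdifferentiableAt (by simp)
    filter_upwards [(hφ x).continuousAt.eventually h1] with y hy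
    change mfderiv I 𝓘(ℝ, E') (ψ ∘ φ) y (Y y) = mfderiv I' 𝓘(ℝ, E') ψ (φ y) (Y' (φ y))
    rw [mfderiv_comp_apply y hy (hφd y), h]
  have hd {Y Z : Π x : M, TangentSpace I x} {Y' Z' : Π y : N, TangentSpace I' y}
      (hY' : MDiffAt (T% Y') (φ x)) (h : ∀ y, mfderiv I I' φ y (Y y) = Y' (φ y))
      (hZ : ∀ y, mfderiv I I' φ y (Z y) = Z' (φ y)) :
      mvfderiv I (fun y ↦ mvfderiv I (ψ ∘ φ) y (Y y)) x (Z x) =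
        mvfderiv I' (fun y ↦ mvfderiv I' ψ y (Y' y)) (φ x) (Z' (φ x)) := by
    rw [mvfderiv_congr (hev h), ← hZ]
    exact mfderiv_comp_apply x (mdifferentiableAt_mvfderiv_apply hψ hY') (hφd x) _
  have h1 := mvfderiv_mlieBracket (hψ.comp x (hφ x)) hV hW
  have h2 := mvfderiv_mlieBracket hψ hV' hW'
  rw [hd hW' hWW hVV, hd hV' hVV hWW, ← h2] at h1
  have h3 : mvfderiv I (ψ ∘ φ) x (mlieBracket I V W x) =
      mvfderiv I' ψ (φ x) (mfderiv I I' φ x (mlieBracket I V W x)) :=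
    mfderiv_comp_apply x (hψ.mdifferentiableAt (by simp)) (hφd x) _
  rw [h3] at h1
  exact (isInvertible_mfderiv_extChartAt (mem_extChartAt_source (φ x))).injective h1

end RelatedFields

namespace PseudoRiemannianMetric

variable {E : Type*} [NormedAddCommGroup E] [NormedSpace ℝ E]
  {H : Type*} [TopologicalSpace H] {I : ModelWithCorners ℝ E H}
  {M : Type*} [TopologicalSpace M] [ChartedSpace H M] [IsManifold I ∞ M]
  (g : PseudoRiemannianMetric I M)

lemma isManifold_minSmoothness : IsManifold I (minSmoothness ℝ 2) M := by
  rw [minSmoothness_of_isRCLikeNormedField]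
  exact IsManifold.of_le (n := ∞) ENat.LEInfty.out

lemma contMDiffAt_trivializationAt_symm (x : M) (e : E) {y : M}
    (hy : y ∈ (trivializationAt E (TangentSpace I : M → Type _) x).baseSet) :
    ContMDiffAt I I.tangent ∞
      (T% (fun z ↦ (trivializationAt E (TangentSpace I : M → Type _) x).symm z e)) y := by
  rw [(trivializationAt E (TangentSpace I : M → Type _) x).contMDiffAt_section_iff hy]
  refine (contMDiffAt_const (c := e)).congr_of_eventuallyEq ?_
  filter_upwards [(trivializationAt E (TangentSpace I : M → Type _) x).open_baseSet.mem_nhds hy]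
    with z hz
  rw [Trivialization.apply_mk_symm _ hz]

lemma contMDiffAt_inner {X Y : Π x : M, TangentSpace I x} {x : M}
    (hX : ContMDiffAt I I.tangent ∞ (T% X) x) (hY : ContMDiffAt I I.tangent ∞ (T% Y) x) :
    ContMDiffAt I 𝓘(ℝ) ∞ (g.inner X Y) x := by
  have h : ContMDiffAt I (I.prod 𝓘(ℝ)) ∞
      (fun m ↦ TotalSpace.mk' ℝ (E := Bundle.Trivial M ℝ) m (g.val m (X m) (Y m))) x := by
    apply ContMDiffAt.clm_bundle_apply₂ (F₁ := E) (F₂ := E)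
    · exact g.contMDiff.contMDiffAt
    · exact hX
    · exact hY
  simp only [contMDiffAt_totalSpace] at h
  exact h.2

variable [FiniteDimensional ℝ E]

/-- A vector field is smooth if its inner products with the coordinate fields of a local
trivialization are smooth. -/
lemma contMDiffAt_of_val {V : Π x : M, TangentSpace I x} {x : M}
    (h : ∀ e : E, ContMDiffAt I 𝓘(ℝ) ∞ (fun y ↦ g.val y (V y)
      ((trivializationAt E (TangentSpace I : M → Type _) x).symm y e)) x) :
    ContMDiffAt I I.tangent ∞ (T% V) x := by
  set t := trivializationAt E (TangentSpace I : M → Type _) x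
  have hx : x ∈ t.baseSet := FiberBundle.mem_baseSet_trivializationAt' x
  obtain ⟨G, hG, hGx⟩ := exists_form_coordinates g.contMDiff x
  rw [t.contMDiffAt_section_iff hx]
  let b := Module.finBasis ℝ E
  let α : M → E →L[ℝ] ℝ := fun y ↦
    ∑ i, g.val y (V y) (t.symm y (b i)) • (b.coord i).toContinuousLinearMap
  have hα : ContMDiffAt I 𝓘(ℝ, E →L[ℝ] ℝ) ∞ α x :=
    ContMDiffAt.sum fun i _ ↦ (h (b i)).smul contMDiffAt_const
  have hinj : Function.Injective ((G x : E →ₗ[ℝ] (E →L[ℝ] ℝ))) := by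
    rw [← LinearMap.ker_eq_bot, LinearMap.ker_eq_bot']
    intro v hv
    have h0 : t.symm x v = 0 := g.nondegenerate x _ fun w ↦ by
      have h1 := hGx.self_of_nhds v (t ⟨x, w⟩).2
      rw [Trivialization.symm_apply_apply_mk _ hx] at h1
      rw [← h1]
      exact congrArg (fun φ : E →L[ℝ] ℝ ↦ φ (t ⟨x, w⟩).2) hv
    have h2 := Trivialization.apply_mk_symm t hx v
    rw [h0] at h2
    have h3 := t.zeroSection ℝ hx
    rw [zeroSection, h2] at h3
    exact congrArg Prod.snd h3
  let A : E ≃L[ℝ] (E →L[ℝ] ℝ) := (LinearEquiv.ofInjectiveOfFinrankEq _ hinj (by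
    rw [← (LinearMap.toContinuousLinearMap : (E →ₗ[ℝ] ℝ) ≃ₗ[ℝ] _).finrank_eq]
    exact Subspace.dual_finrank_eq.symm)).toContinuousLinearEquiv
  have hA : (A : E →L[ℝ] (E →L[ℝ] ℝ)) = G x := by ext; rfl
  have hinv : ContMDiffAt I 𝓘(ℝ, (E →L[ℝ] ℝ) →L[ℝ] E) ∞ (fun y ↦ (G y).inverse) x := by
    have h1 : ContDiffAt ℝ ∞ ContinuousLinearMap.inverse (G x) := by
      rw [← hA]; exact contDiffAt_map_inverse A
    exact h1.contMDiffAt.comp x hG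
  refine (hinv.clm_apply hα).congr_of_eventuallyEq ?_
  have hev : ∀ᶠ y in nhds x, (G y).IsInvertible := by
    refine hG.continuousAt.eventually (p := fun B ↦ ContinuousLinearMap.IsInvertible B) ?_
    rw [← hA]
    filter_upwards [A.nhds] with B hB
    exact hB
  filter_upwards [hev, hGx, t.open_baseSet.mem_nhds hx] with y hyi hyG hy
  have h1 : α y = G y (t ⟨y, V y⟩).2 := by
    refine ContinuousLinearMap.coe_injective (b.ext fun i ↦ ?_)
    have h2 := hyG (t ⟨y, V y⟩).2 (b i)
    rw [Trivialization.symm_apply_apply_mk _ hy] at h2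
    simp only [ContinuousLinearMap.coe_coe]
    rw [h2]
    simp [α, Finsupp.single_apply]
    rfl
  rw [h1, hyi.inverse_apply_self]

lemma contMDiffAt_mlieBracket {X Y : Π x : M, TangentSpace I x} {x : M}
    (hX : ContMDiffAt I I.tangent ∞ (T% X) x) (hY : ContMDiffAt I I.tangent ∞ (T% Y) x) :
    ContMDiffAt I I.tangent ∞ (T% (mlieBracket I X Y)) x := by
  have : IsManifold I (((⊤ : ℕ∞) : ℕ∞ω) + 1) M := by
    change IsManifold I ∞ M
    infer_instance
  have : IsManifold I (minSmoothness ℝ 2) M := isManifold_minSmoothness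
  have : CompleteSpace E := FiniteDimensional.complete ℝ E
  exact ContMDiffAt.mlieBracket_vectorField (m := ⊤) (n := ⊤) hX hY (by simp)

lemma contMDiff_gradient {f : M → ℝ} (hf : ContMDiff I 𝓘(ℝ) ∞ f) :
    ContMDiff I I.tangent ∞ (T% (g.gradient f)) := fun x ↦
  g.contMDiffAt_of_val fun e ↦ by
    simp only [gradient, val_flat_symm]
    exact contMDiffAt_mvfderiv_apply (hf x)
      (contMDiffAt_trivializationAt_symm x e (FiberBundle.mem_baseSet_trivializationAt' x))

lemma contMDiff_nabla {X Y : Π x : M, TangentSpace I x}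
    (hX : ContMDiff I I.tangent ∞ (T% X)) (hY : ContMDiff I I.tangent ∞ (T% Y)) :
    ContMDiff I I.tangent ∞ (T% (g.nabla X Y)) := by
  refine fun x ↦ g.contMDiffAt_of_val fun e ↦ ?_
  set t := trivializationAt E (TangentSpace I : M → Type _) x
  have hx : x ∈ t.baseSet := FiberBundle.mem_baseSet_trivializationAt' x
  set W : Π y : M, TangentSpace I y := fun y ↦ t.symm y e
  have hW {y : M} (hy : y ∈ t.baseSet) : ContMDiffAt I I.tangent ∞ (T% W) y :=
    contMDiffAt_trivializationAt_symm x e hy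
  have hk : ContMDiffAt I 𝓘(ℝ) ∞ (fun y ↦ (1 / 2 : ℝ) * g.koszul X Y W y) x := by
    refine contMDiffAt_const.mul ?_
    have h1 := contMDiffAt_mvfderiv_apply (g.contMDiffAt_inner (hY x) (hW hx)) (hX x)
    have h2 := contMDiffAt_mvfderiv_apply (g.contMDiffAt_inner (hW hx) (hX x)) (hY x)
    have h3 := contMDiffAt_mvfderiv_apply (g.contMDiffAt_inner (hX x) (hY x)) (hW hx)
    have h4 := g.contMDiffAt_inner (hX x) (contMDiffAt_mlieBracket (hY x) (hW hx))
    have h5 := g.contMDiffAt_inner (hY x) (contMDiffAt_mlieBracket (hW hx) (hX x))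
    have h6 := g.contMDiffAt_inner (hW hx) (contMDiffAt_mlieBracket (hX x) (hY x))
    exact ((((h1.add h2).sub h3).sub h4).add h5).add h6
  refine hk.congr_of_eventuallyEq ?_
  filter_upwards [t.open_baseSet.mem_nhds hx] with y hy
  rw [← g.two_mul_val_leviCivita ((hX y).mdifferentiableAt (by simp))
    ((hY y).mdifferentiableAt (by simp)) ((hW hy).mdifferentiableAt (by simp))]
  simp [nabla, W]

end PseudoRiemannianMetric

section Lifts

variable {E₁ : Type*} [NormedAddCommGroup E₁] [NormedSpace ℝ E₁]
  {H₁ : Type*} [TopologicalSpace H₁] {I₁ : ModelWithCorners ℝ E₁ H₁}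
  {M₁ : Type*} [TopologicalSpace M₁] [ChartedSpace H₁ M₁]
  {E₂ : Type*} [NormedAddCommGroup E₂] [NormedSpace ℝ E₂]
  {H₂ : Type*} [TopologicalSpace H₂] {I₂ : ModelWithCorners ℝ E₂ H₂}
  {M₂ : Type*} [TopologicalSpace M₂] [ChartedSpace H₂ M₂]

lemma liftLeft_apply (X : Π p : M₁, TangentSpace I₁ p) (z : M₁ × M₂) :
    liftLeft I₁ I₂ M₂ X z = ((X z.1, 0) : E₁ × E₂) := by
  have h := mfderiv_prod_left (I := I₁) (I' := I₂) (x₀ := z.1) (y₀ := z.2)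
  exact congrArg (fun A : E₁ →L[ℝ] E₁ × E₂ ↦ A (X z.1)) h

lemma liftRight_apply (X : Π q : M₂, TangentSpace I₂ q) (z : M₁ × M₂) :
    liftRight I₁ M₁ I₂ X z = ((0, X z.2) : E₁ × E₂) := by
  have h := mfderiv_prod_right (I := I₁) (I' := I₂) (x₀ := z.1) (y₀ := z.2)
  exact congrArg (fun A : E₂ →L[ℝ] E₁ × E₂ ↦ A (X z.2)) h

lemma mfderiv_fst_apply (z : M₁ × M₂) (v : TangentSpace (I₁.prod I₂) z) :
    mfderiv (I₁.prod I₂) I₁ Prod.fst z v = v.1 := by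
  rw [mfderiv_fst]; rfl

lemma mfderiv_snd_apply (z : M₁ × M₂) (v : TangentSpace (I₁.prod I₂) z) :
    mfderiv (I₁.prod I₂) I₂ Prod.snd z v = v.2 := by
  rw [mfderiv_snd]; rfl

lemma mfderiv_fst_liftLeft (X : Π p : M₁, TangentSpace I₁ p) (z : M₁ × M₂) :
    mfderiv (I₁.prod I₂) I₁ Prod.fst z (liftLeft I₁ I₂ M₂ X z) = X z.1 := by
  rw [mfderiv_fst_apply, liftLeft_apply]

lemma mfderiv_snd_liftLeft (X : Π p : M₁, TangentSpace I₁ p) (z : M₁ × M₂) :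
    mfderiv (I₁.prod I₂) I₂ Prod.snd z (liftLeft I₁ I₂ M₂ X z) = 0 := by
  rw [mfderiv_snd_apply, liftLeft_apply]; rfl

lemma mfderiv_fst_liftRight (X : Π q : M₂, TangentSpace I₂ q) (z : M₁ × M₂) :
    mfderiv (I₁.prod I₂) I₁ Prod.fst z (liftRight I₁ M₁ I₂ X z) = 0 := by
  rw [mfderiv_fst_apply, liftRight_apply]; rfl

lemma mfderiv_snd_liftRight (X : Π q : M₂, TangentSpace I₂ q) (z : M₁ × M₂) :
    mfderiv (I₁.prod I₂) I₂ Prod.snd z (liftRight I₁ M₁ I₂ X z) = X z.2 := by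
  rw [mfderiv_snd_apply, liftRight_apply]

/-- A tangent vector of a product is determined by its two projections. -/
lemma tangentSpace_prod_ext {z : M₁ × M₂} {v w : TangentSpace (I₁.prod I₂) z}
    (h₁ : mfderiv (I₁.prod I₂) I₁ Prod.fst z v = mfderiv (I₁.prod I₂) I₁ Prod.fst z w)
    (h₂ : mfderiv (I₁.prod I₂) I₂ Prod.snd z v = mfderiv (I₁.prod I₂) I₂ Prod.snd z w) :
    v = w := by
  rw [mfderiv_fst_apply, mfderiv_fst_apply] at h₁
  rw [mfderiv_snd_apply, mfderiv_snd_apply] at h₂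
  exact Prod.ext h₁ h₂

section Functions

variable {h : M₁ → ℝ} {k : M₂ → ℝ} {z : M₁ × M₂}

lemma mvfderiv_comp_fst_liftLeft (hh : MDiffAt h z.1) (X : Π p : M₁, TangentSpace I₁ p) :
    mvfderiv (I₁.prod I₂) (h ∘ Prod.fst) z (liftLeft I₁ I₂ M₂ X z) =
      mvfderiv I₁ h z.1 (X z.1) := by
  rw [mvfderiv_comp_apply z hh mdifferentiableAt_fst, mfderiv_fst_liftLeft]

lemma mvfderiv_comp_fst_liftRight (hh : MDiffAt h z.1) (X : Π q : M₂, TangentSpace I₂ q) :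
    mvfderiv (I₁.prod I₂) (h ∘ Prod.fst) z (liftRight I₁ M₁ I₂ X z) = 0 := by
  rw [mvfderiv_comp_apply z hh mdifferentiableAt_fst, mfderiv_fst_liftRight, map_zero]

lemma mvfderiv_comp_snd_liftLeft (hk : MDiffAt k z.2) (X : Π p : M₁, TangentSpace I₁ p) :
    mvfderiv (I₁.prod I₂) (k ∘ Prod.snd) z (liftLeft I₁ I₂ M₂ X z) = 0 := by
  rw [mvfderiv_comp_apply z hk mdifferentiableAt_snd, mfderiv_snd_liftLeft, map_zero]

lemma mvfderiv_comp_snd_liftRight (hk : MDiffAt k z.2) (X : Π q : M₂, TangentSpace I₂ q) :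
    mvfderiv (I₁.prod I₂) (k ∘ Prod.snd) z (liftRight I₁ M₁ I₂ X z) =
      mvfderiv I₂ k z.2 (X z.2) := by
  rw [mvfderiv_comp_apply z hk mdifferentiableAt_snd, mfderiv_snd_liftRight]

lemma mvfderiv_mul_comp_prod (hh : MDiffAt h z.1) (hk : MDiffAt k z.2)
    (v : TangentSpace (I₁.prod I₂) z) :
    mvfderiv (I₁.prod I₂) ((h ∘ Prod.fst) * (k ∘ Prod.snd)) z v =
      h z.1 * mvfderiv (I₁.prod I₂) (k ∘ Prod.snd) z v +
      k z.2 * mvfderiv (I₁.prod I₂) (h ∘ Prod.fst) z v := by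
  rw [mvfderiv_mul (hh.comp z mdifferentiableAt_fst) (hk.comp z mdifferentiableAt_snd)]
  simp

end Functions

variable [IsManifold I₁ ∞ M₁] [IsManifold I₂ ∞ M₂]

lemma exists_lifts_eq (z : M₁ × M₂) (v : TangentSpace (I₁.prod I₂) z) :
    ∃ (X : Π p : M₁, TangentSpace I₁ p) (Y : Π q : M₂, TangentSpace I₂ q),
      MDiffAt (T% X) z.1 ∧ MDiffAt (T% Y) z.2 ∧
        v = liftLeft I₁ I₂ M₂ X z + liftRight I₁ M₁ I₂ Y z := by
  refine ⟨extend E₁ (mfderiv (I₁.prod I₂) I₁ Prod.fst z v),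
    extend E₂ (mfderiv (I₁.prod I₂) I₂ Prod.snd z v), mdifferentiableAt_extend ..,
    mdifferentiableAt_extend .., tangentSpace_prod_ext ?_ ?_⟩
  · rw [map_add, mfderiv_fst_liftLeft, mfderiv_fst_liftRight, add_zero, extend_apply_self]
  · rw [map_add, mfderiv_snd_liftLeft, mfderiv_snd_liftRight, zero_add, extend_apply_self]

lemma mdifferentiableAt_liftLeft {X : Π p : M₁, TangentSpace I₁ p} {z : M₁ × M₂}
    (hX : MDiffAt (T% X) z.1) : MDiffAt (T% (liftLeft I₁ I₂ M₂ X)) z := by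
  have h1 : MDiffAt (fun w : M₁ × M₂ ↦ ((⟨w.1, X w.1⟩, ⟨w.2, 0⟩) :
      TangentBundle I₁ M₁ × TangentBundle I₂ M₂)) z := by
    refine MDifferentiableAt.prodMk (hX.comp z mdifferentiableAt_fst) ?_
    exact (mdifferentiableAt_zeroSection ..).comp z mdifferentiableAt_snd
  have h2 := ((contMDiff_equivTangentBundleProd_symm (I := I₁) (I' := I₂) (M := M₁) (M' := M₂)
    (n := 1)).mdifferentiable (by simp) _).comp z h1
  convert h2 using 2 with w
  exact congrArg (TotalSpace.mk' (E₁ × E₂) w) (liftLeft_apply X w)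

lemma mdifferentiableAt_liftRight {X : Π q : M₂, TangentSpace I₂ q} {z : M₁ × M₂}
    (hX : MDiffAt (T% X) z.2) : MDiffAt (T% (liftRight I₁ M₁ I₂ X)) z := by
  have h1 : MDiffAt (fun w : M₁ × M₂ ↦ ((⟨w.1, 0⟩, ⟨w.2, X w.2⟩) :
      TangentBundle I₁ M₁ × TangentBundle I₂ M₂)) z := by
    refine MDifferentiableAt.prodMk ?_ (hX.comp z mdifferentiableAt_snd)
    exact (mdifferentiableAt_zeroSection ..).comp z mdifferentiableAt_fst
  have h2 := ((contMDiff_equivTangentBundleProd_symm (I := I₁) (I' := I₂) (M := M₁) (M' := M₂)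
    (n := 1)).mdifferentiable (by simp) _).comp z h1
  convert h2 using 2 with w
  exact congrArg (TotalSpace.mk' (E₁ × E₂) w) (liftRight_apply X w)

section Bracket

variable [FiniteDimensional ℝ E₁] [FiniteDimensional ℝ E₂]

lemma mlieBracket_liftLeft {X Y : Π p : M₁, TangentSpace I₁ p} {z : M₁ × M₂}
    (hX : MDiffAt (T% X) z.1) (hY : MDiffAt (T% Y) z.1) :
    mlieBracket (I₁.prod I₂) (liftLeft I₁ I₂ M₂ X) (liftLeft I₁ I₂ M₂ Y) z =
      liftLeft I₁ I₂ M₂ (mlieBracket I₁ X Y) z := by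
  have := FiniteDimensional.complete ℝ E₁
  have := FiniteDimensional.complete ℝ E₂
  have hLX := mdifferentiableAt_liftLeft (I₂ := I₂) (z := z) hX
  have hLY := mdifferentiableAt_liftLeft (I₂ := I₂) (z := z) hY
  have h0 : MDiffAt (T% (0 : Π q : M₂, TangentSpace I₂ q)) z.2 := mdifferentiableAt_zeroSection ..
  apply tangentSpace_prod_ext
  · rw [mfderiv_fst_liftLeft]
    exact mfderiv_mlieBracket_of_related contMDiff_fst hLX hLY hX hY
      (mfderiv_fst_liftLeft X) (mfderiv_fst_liftLeft Y)
  · rw [mfderiv_snd_liftLeft, mfderiv_mlieBracket_of_related (V' := 0) (W' := 0)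
      contMDiff_snd hLX hLY h0 h0
      (mfderiv_snd_liftLeft X) (mfderiv_snd_liftLeft Y), mlieBracket_zero_left]
    rfl

lemma mlieBracket_liftRight {X Y : Π q : M₂, TangentSpace I₂ q} {z : M₁ × M₂}
    (hX : MDiffAt (T% X) z.2) (hY : MDiffAt (T% Y) z.2) :
    mlieBracket (I₁.prod I₂) (liftRight I₁ M₁ I₂ X) (liftRight I₁ M₁ I₂ Y) z =
      liftRight I₁ M₁ I₂ (mlieBracket I₂ X Y) z := by
  have := FiniteDimensional.complete ℝ E₁
  have := FiniteDimensional.complete ℝ E₂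
  have hLX := mdifferentiableAt_liftRight (I₁ := I₁) (z := z) hX
  have hLY := mdifferentiableAt_liftRight (I₁ := I₁) (z := z) hY
  have h0 : MDiffAt (T% (0 : Π q : M₁, TangentSpace I₁ q)) z.1 := mdifferentiableAt_zeroSection ..
  apply tangentSpace_prod_ext
  · rw [mfderiv_fst_liftRight, mfderiv_mlieBracket_of_related (V' := 0) (W' := 0)
      contMDiff_fst hLX hLY h0 h0
      (mfderiv_fst_liftRight X) (mfderiv_fst_liftRight Y), mlieBracket_zero_left]
    rfl
  · rw [mfderiv_snd_liftRight]
    exact mfderiv_mlieBracket_of_related contMDiff_snd hLX hLY hX hY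
      (mfderiv_snd_liftRight X) (mfderiv_snd_liftRight Y)

lemma mlieBracket_liftLeft_liftRight {X : Π p : M₁, TangentSpace I₁ p}
    {Y : Π q : M₂, TangentSpace I₂ q} {z : M₁ × M₂}
    (hX : MDiffAt (T% X) z.1) (hY : MDiffAt (T% Y) z.2) :
    mlieBracket (I₁.prod I₂) (liftLeft I₁ I₂ M₂ X) (liftRight I₁ M₁ I₂ Y) z = 0 := by
  have := FiniteDimensional.complete ℝ E₁
  have := FiniteDimensional.complete ℝ E₂
  have hLX := mdifferentiableAt_liftLeft (I₂ := I₂) (z := z) hX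
  have hRY := mdifferentiableAt_liftRight (I₁ := I₁) (z := z) hY
  have h1 : MDiffAt (T% (0 : Π q : M₁, TangentSpace I₁ q)) z.1 := mdifferentiableAt_zeroSection ..
  have h2 : MDiffAt (T% (0 : Π q : M₂, TangentSpace I₂ q)) z.2 := mdifferentiableAt_zeroSection ..
  apply tangentSpace_prod_ext
  · rw [mfderiv_mlieBracket_of_related (V' := X) (W' := 0)
      contMDiff_fst hLX hRY hX h1
      (mfderiv_fst_liftLeft X) (mfderiv_fst_liftRight Y), mlieBracket_zero_right, map_zero]
    rfl
  · rw [mfderiv_mlieBracket_of_related (V' := 0) (W' := Y)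
      contMDiff_snd hLX hRY h2 hY
      (mfderiv_snd_liftLeft X) (mfderiv_snd_liftRight Y), mlieBracket_zero_left, map_zero]
    rfl

end Bracket

end Lifts

namespace PseudoRiemannianMetric

section Rules

variable {E : Type*} [NormedAddCommGroup E] [NormedSpace ℝ E] [FiniteDimensional ℝ E]
  {H : Type*} [TopologicalSpace H] {I : ModelWithCorners ℝ E H}
  {M : Type*} [TopologicalSpace M] [ChartedSpace H M] [IsManifold I ∞ M]
  (g : PseudoRiemannianMetric I M)

lemma val_gradient (f : M → ℝ) (x : M) (v : TangentSpace I x) :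
    g.val x (g.gradient f x) v = mvfderiv I f x v := g.val_flat_symm x _ v

lemma nabla_sub_nabla {X Y : Π x : M, TangentSpace I x} {x : M}
    (hX : MDiffAt (T% X) x) (hY : MDiffAt (T% Y) x) :
    g.nabla X Y x - g.nabla Y X x = mlieBracket I X Y x :=
  g.leviCivita.torsion_eq_zero_iff.1 g.leviCivita_torsion hX hY

lemma nabla_add {X Y Y' : Π x : M, TangentSpace I x} {x : M}
    (hY : MDiffAt (T% Y) x) (hY' : MDiffAt (T% Y') x) :
    g.nabla X (Y + Y') x = g.nabla X Y x + g.nabla X Y' x := by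
  have h := g.leviCivita.isCovariantDerivativeOnUniv.add hY hY'
  exact congrArg (fun A : TangentSpace I x →L[ℝ] TangentSpace I x ↦ A (X x)) h

lemma nabla_smul {X Y : Π x : M, TangentSpace I x} {h : M → ℝ} {x : M}
    (hY : MDiffAt (T% Y) x) (hh : MDiffAt h x) :
    g.nabla X (h • Y) x = h x • g.nabla X Y x + mvfderiv I h x (X x) • Y x := by
  have h := g.leviCivita.isCovariantDerivativeOnUniv.leibniz hY hh
  exact congrArg (fun A : TangentSpace I x →L[ℝ] TangentSpace I x ↦ A (X x)) h

lemma nabla_sub {X Y Y' : Π x : M, TangentSpace I x} {x : M}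
    (hY : MDiffAt (T% Y) x) (hY' : MDiffAt (T% Y') x) :
    g.nabla X (Y - Y') x = g.nabla X Y x - g.nabla X Y' x := by
  have h1 : Y - Y' = Y + (fun _ : M ↦ (-1 : ℝ)) • Y' := by
    ext x; simp [sub_eq_add_neg]
  have hc : MDiffAt (fun _ : M ↦ (-1 : ℝ)) x := mdifferentiableAt_const
  rw [h1, g.nabla_add hY (hc.smul_section hY'), g.nabla_smul hY' hc, mvfderiv_const]
  simp [sub_eq_add_neg]

lemma nabla_congr_left {X X' Y : Π x : M, TangentSpace I x} {x : M} (h : X x = X' x) :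
    g.nabla X Y x = g.nabla X' Y x := by
  simp only [nabla, h]

lemma mvfderiv_inner {X Y Z : Π x : M, TangentSpace I x} {x : M} (hX : MDiffAt (T% X) x)
    (hY : MDiffAt (T% Y) x) (hZ : MDiffAt (T% Z) x) :
    mvfderiv I (g.inner Y Z) x (X x) = g.inner (g.nabla X Y) Z x + g.inner Y (g.nabla X Z) x :=
  g.leviCivita_metric hX hY hZ

lemma two_mul_inner_nabla {X Y Z : Π x : M, TangentSpace I x} {x : M}
    (hX : MDiffAt (T% X) x) (hY : MDiffAt (T% Y) x) (hZ : MDiffAt (T% Z) x) :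
    2 * g.inner (g.nabla X Y) Z x = g.koszul X Y Z x := g.two_mul_val_leviCivita hX hY hZ

lemma curvature_swap (X Y Z : Π x : M, TangentSpace I x) (x : M) :
    g.curvature Y X Z x = -g.curvature X Y Z x := by
  simp only [curvature, Pi.add_apply, Pi.sub_apply]
  rw [show g.nabla (mlieBracket I Y X) Z x = -g.nabla (mlieBracket I X Y) Z x by
    simp only [nabla]; rw [mlieBracket_swap_apply, map_neg]]
  abel

lemma concircular_swap (X Y Z : Π x : M, TangentSpace I x) (x : M) :
    g.concircular Y X Z x = -g.concircular X Y Z x := by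
  simp only [concircular]
  rw [curvature_swap]
  module

end Rules

end PseudoRiemannianMetric

section Warped

variable {E₁ : Type*} [NormedAddCommGroup E₁] [NormedSpace ℝ E₁]
  {H₁ : Type*} [TopologicalSpace H₁] {I₁ : ModelWithCorners ℝ E₁ H₁}
  {M₁ : Type*} [TopologicalSpace M₁] [ChartedSpace H₁ M₁] [IsManifold I₁ ∞ M₁]
  {E₂ : Type*} [NormedAddCommGroup E₂] [NormedSpace ℝ E₂]
  {H₂ : Type*} [TopologicalSpace H₂] {I₂ : ModelWithCorners ℝ E₂ H₂}
  {M₂ : Type*} [TopologicalSpace M₂] [ChartedSpace H₂ M₂] [IsManifold I₂ ∞ M₂]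
  (g₁ : PseudoRiemannianMetric I₁ M₁) (g₂ : PseudoRiemannianMetric I₂ M₂)
  {f : M₁ → ℝ} (hf : ContMDiff I₁ 𝓘(ℝ) ∞ f) (hpos : ∀ p, 0 < f p) {z : M₁ × M₂}

lemma warpedProductMetric_val (z : M₁ × M₂) (v w : TangentSpace (I₁.prod I₂) z) :
    (warpedProductMetric g₁ g₂ f hf hpos).val z v w =
      g₁.val z.1 (mfderiv (I₁.prod I₂) I₁ Prod.fst z v) (mfderiv (I₁.prod I₂) I₁ Prod.fst z w) +
      f z.1 ^ 2 * g₂.val z.2 (mfderiv (I₁.prod I₂) I₂ Prod.snd z v)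
        (mfderiv (I₁.prod I₂) I₂ Prod.snd z w) := rfl

lemma warpedProductMetric_inner_liftLeft (X Y : Π p : M₁, TangentSpace I₁ p) :
    (warpedProductMetric g₁ g₂ f hf hpos).inner (liftLeft I₁ I₂ M₂ X) (liftLeft I₁ I₂ M₂ Y) =
      g₁.inner X Y ∘ Prod.fst := by
  ext z
  simp only [PseudoRiemannianMetric.inner, warpedProductMetric_val, mfderiv_fst_liftLeft,
    mfderiv_snd_liftLeft]
  simp [PseudoRiemannianMetric.inner]

lemma warpedProductMetric_inner_liftRight (X Y : Π q : M₂, TangentSpace I₂ q) :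
    (warpedProductMetric g₁ g₂ f hf hpos).inner (liftRight I₁ M₁ I₂ X) (liftRight I₁ M₁ I₂ Y) =
      ((fun p ↦ f p ^ 2) ∘ Prod.fst) * (g₂.inner X Y ∘ Prod.snd) := by
  ext z
  simp only [PseudoRiemannianMetric.inner, warpedProductMetric_val, mfderiv_fst_liftRight,
    mfderiv_snd_liftRight]
  simp [PseudoRiemannianMetric.inner]

lemma warpedProductMetric_inner_liftLeft_liftRight (X : Π p : M₁, TangentSpace I₁ p)
    (Y : Π q : M₂, TangentSpace I₂ q) :
    (warpedProductMetric g₁ g₂ f hf hpos).inner (liftLeft I₁ I₂ M₂ X) (liftRight I₁ M₁ I₂ Y) =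
      0 := by
  ext z
  simp only [PseudoRiemannianMetric.inner, warpedProductMetric_val, mfderiv_fst_liftLeft,
    mfderiv_snd_liftLeft, mfderiv_fst_liftRight]
  simp

lemma warpedProductMetric_inner_liftRight_liftLeft (X : Π p : M₁, TangentSpace I₁ p)
    (Y : Π q : M₂, TangentSpace I₂ q) :
    (warpedProductMetric g₁ g₂ f hf hpos).inner (liftRight I₁ M₁ I₂ Y) (liftLeft I₁ I₂ M₂ X) =
      0 := by
  rw [PseudoRiemannianMetric.inner_comm, warpedProductMetric_inner_liftLeft_liftRight]

lemma warpedProductMetric_val_liftLeft_liftLeft (X Y : Π p : M₁, TangentSpace I₁ p) :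
    (warpedProductMetric g₁ g₂ f hf hpos).val z (liftLeft I₁ I₂ M₂ X z) (liftLeft I₁ I₂ M₂ Y z) =
      g₁.val z.1 (X z.1) (Y z.1) :=
  congrFun (warpedProductMetric_inner_liftLeft g₁ g₂ hf hpos X Y) z

lemma warpedProductMetric_val_liftRight_liftRight (X Y : Π q : M₂, TangentSpace I₂ q) :
    (warpedProductMetric g₁ g₂ f hf hpos).val z
      (liftRight I₁ M₁ I₂ X z) (liftRight I₁ M₁ I₂ Y z) =
      f z.1 ^ 2 * g₂.val z.2 (X z.2) (Y z.2) :=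
  congrFun (warpedProductMetric_inner_liftRight g₁ g₂ hf hpos X Y) z

lemma warpedProductMetric_val_liftLeft_liftRight (X : Π p : M₁, TangentSpace I₁ p)
    (Y : Π q : M₂, TangentSpace I₂ q) :
    (warpedProductMetric g₁ g₂ f hf hpos).val z
      (liftLeft I₁ I₂ M₂ X z) (liftRight I₁ M₁ I₂ Y z) = 0 :=
  congrFun (warpedProductMetric_inner_liftLeft_liftRight g₁ g₂ hf hpos X Y) z

lemma warpedProductMetric_val_liftRight_liftLeft (X : Π p : M₁, TangentSpace I₁ p)
    (Y : Π q : M₂, TangentSpace I₂ q) :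
    (warpedProductMetric g₁ g₂ f hf hpos).val z
      (liftRight I₁ M₁ I₂ Y z) (liftLeft I₁ I₂ M₂ X z) = 0 :=
  congrFun (warpedProductMetric_inner_liftRight_liftLeft g₁ g₂ hf hpos X Y) z

/-- Tangent vectors of a warped product are determined by their inner products with lifts. -/
lemma warpedProductMetric_ext {V V' : Π z : M₁ × M₂, TangentSpace (I₁.prod I₂) z}
    (h₁ : ∀ W : Π p : M₁, TangentSpace I₁ p, MDiffAt (T% W) z.1 →
      (warpedProductMetric g₁ g₂ f hf hpos).inner V (liftLeft I₁ I₂ M₂ W) z =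
        (warpedProductMetric g₁ g₂ f hf hpos).inner V' (liftLeft I₁ I₂ M₂ W) z)
    (h₂ : ∀ W : Π q : M₂, TangentSpace I₂ q, MDiffAt (T% W) z.2 →
      (warpedProductMetric g₁ g₂ f hf hpos).inner V (liftRight I₁ M₁ I₂ W) z =
        (warpedProductMetric g₁ g₂ f hf hpos).inner V' (liftRight I₁ M₁ I₂ W) z) :
    V z = V' z := by
  rw [← sub_eq_zero]
  refine (warpedProductMetric g₁ g₂ f hf hpos).nondegenerate z _ fun w ↦ ?_
  obtain ⟨X, Y, hX, hY, rfl⟩ := exists_lifts_eq z w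
  have e₁ := h₁ X hX
  have e₂ := h₂ Y hY
  simp only [PseudoRiemannianMetric.inner] at e₁ e₂
  simp only [map_add, map_sub, sub_apply]
  rw [e₁, e₂]
  ring

end Warped

section WarpedNabla

variable {E₁ : Type*} [NormedAddCommGroup E₁] [NormedSpace ℝ E₁] [FiniteDimensional ℝ E₁]
  {H₁ : Type*} [TopologicalSpace H₁] {I₁ : ModelWithCorners ℝ E₁ H₁}
  {M₁ : Type*} [TopologicalSpace M₁] [ChartedSpace H₁ M₁] [IsManifold I₁ ∞ M₁]
  {E₂ : Type*} [NormedAddCommGroup E₂] [NormedSpace ℝ E₂] [FiniteDimensional ℝ E₂]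
  {H₂ : Type*} [TopologicalSpace H₂] {I₂ : ModelWithCorners ℝ E₂ H₂}
  {M₂ : Type*} [TopologicalSpace M₂] [ChartedSpace H₂ M₂] [IsManifold I₂ ∞ M₂]
  (g₁ : PseudoRiemannianMetric I₁ M₁) (g₂ : PseudoRiemannianMetric I₂ M₂)
  {f : M₁ → ℝ} (hf : ContMDiff I₁ 𝓘(ℝ) ∞ f) (hpos : ∀ p, 0 < f p) {z : M₁ × M₂}

lemma mlieBracket_liftRight_liftLeft {X : Π p : M₁, TangentSpace I₁ p}
    {Y : Π q : M₂, TangentSpace I₂ q}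
    (hX : MDiffAt (T% X) z.1) (hY : MDiffAt (T% Y) z.2) :
    mlieBracket (I₁.prod I₂) (liftRight I₁ M₁ I₂ Y) (liftLeft I₁ I₂ M₂ X) z = 0 := by
  rw [mlieBracket_swap_apply, mlieBracket_liftLeft_liftRight hX hY, neg_zero]

/-- `∇_X Y` is the lift of `∇¹_X Y` for lifts of vector fields on the base. -/
lemma warpedProductMetric_nabla_liftLeft_liftLeft (X : Π p : M₁, TangentSpace I₁ p)
    {Y : Π p : M₁, TangentSpace I₁ p} (hY : MDiffAt (T% Y) z.1) :
    (warpedProductMetric g₁ g₂ f hf hpos).nabla (liftLeft I₁ I₂ M₂ X) (liftLeft I₁ I₂ M₂ Y) z =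
      liftLeft I₁ I₂ M₂ (g₁.nabla X Y) z := by
  wlog hX : MDiffAt (T% X) z.1 generalizing X
  · have h := this (extend E₁ (X z.1)) (mdifferentiableAt_extend ..)
    rw [(warpedProductMetric g₁ g₂ f hf hpos).nabla_congr_left (X' := liftLeft I₁ I₂ M₂ X)
      (by simp only [liftLeft, extend_apply_self])] at h
    rw [h]
    simp only [liftLeft, PseudoRiemannianMetric.nabla, extend_apply_self]
  refine warpedProductMetric_ext g₁ g₂ hf hpos (fun W hW ↦ ?_) (fun W hW ↦ ?_)
  · have h := (warpedProductMetric g₁ g₂ f hf hpos).two_mul_inner_nabla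
      (mdifferentiableAt_liftLeft hX) (mdifferentiableAt_liftLeft hY)
      (mdifferentiableAt_liftLeft hW)
    have h' := g₁.two_mul_inner_nabla hX hY hW
    simp only [PseudoRiemannianMetric.koszul, warpedProductMetric_inner_liftLeft,
      mlieBracket_liftLeft hX hY, mlieBracket_liftLeft hY hW, mlieBracket_liftLeft hW hX,
      mvfderiv_comp_fst_liftLeft (g₁.mdifferentiableAt_inner hX hY),
      mvfderiv_comp_fst_liftLeft (g₁.mdifferentiableAt_inner hY hW),
      mvfderiv_comp_fst_liftLeft (g₁.mdifferentiableAt_inner hW hX),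
      warpedProductMetric_val_liftLeft_liftLeft] at h h' ⊢
    rw [Function.comp_apply]
    linarith
  · have h := (warpedProductMetric g₁ g₂ f hf hpos).two_mul_inner_nabla
      (mdifferentiableAt_liftLeft hX) (mdifferentiableAt_liftLeft hY)
      (mdifferentiableAt_liftRight hW)
    simp only [PseudoRiemannianMetric.koszul, warpedProductMetric_inner_liftLeft,
      warpedProductMetric_inner_liftLeft_liftRight, warpedProductMetric_inner_liftRight_liftLeft,
      mlieBracket_liftLeft hX hY, mlieBracket_liftLeft_liftRight hY hW,
      mlieBracket_liftRight_liftLeft hX hW,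
      mvfderiv_comp_fst_liftRight (g₁.mdifferentiableAt_inner hX hY),
      warpedProductMetric_val_liftRight_liftLeft] at h ⊢
    simp at h ⊢
    exact h

/-- `∇_X Y = (X f / f) Y` for lifts of `X` from the base and `Y` from the fibre. -/
lemma warpedProductMetric_nabla_liftLeft_liftRight (X : Π p : M₁, TangentSpace I₁ p)
    {Y : Π q : M₂, TangentSpace I₂ q} (hY : MDiffAt (T% Y) z.2) :
    (warpedProductMetric g₁ g₂ f hf hpos).nabla (liftLeft I₁ I₂ M₂ X) (liftRight I₁ M₁ I₂ Y) z =
      (mvfderiv I₁ f z.1 (X z.1) / f z.1) • liftRight I₁ M₁ I₂ Y z := by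
  wlog hX : MDiffAt (T% X) z.1 generalizing X
  · have h := this (extend E₁ (X z.1)) (mdifferentiableAt_extend ..)
    rw [(warpedProductMetric g₁ g₂ f hf hpos).nabla_congr_left (X' := liftLeft I₁ I₂ M₂ X)
      (by simp only [liftLeft, extend_apply_self]), extend_apply_self] at h
    exact h
  have hfz : MDiffAt f z.1 := (hf z.1).mdifferentiableAt (by simp)
  have hfz2 : MDiffAt (fun p ↦ f p ^ 2) z.1 := ((hf.pow 2) z.1).mdifferentiableAt (by simp)
  refine warpedProductMetric_ext g₁ g₂ hf hpos
    (V' := (fun _ : M₁ × M₂ ↦ mvfderiv I₁ f z.1 (X z.1) / f z.1) • liftRight I₁ M₁ I₂ Y)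
    (fun W hW ↦ ?_) (fun W hW ↦ ?_) <;> rw [PseudoRiemannianMetric.inner_smul_left]
  · have h := (warpedProductMetric g₁ g₂ f hf hpos).two_mul_inner_nabla
      (mdifferentiableAt_liftLeft hX) (mdifferentiableAt_liftRight hY)
      (mdifferentiableAt_liftLeft hW)
    simp only [PseudoRiemannianMetric.koszul, warpedProductMetric_inner_liftLeft,
      warpedProductMetric_inner_liftLeft_liftRight, warpedProductMetric_inner_liftRight_liftLeft,
      mlieBracket_liftLeft hW hX, mlieBracket_liftLeft_liftRight hX hY,
      mlieBracket_liftRight_liftLeft hW hY,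
      mvfderiv_comp_fst_liftRight (g₁.mdifferentiableAt_inner hW hX),
      warpedProductMetric_val_liftRight_liftLeft] at h ⊢
    simp at h ⊢
    exact h
  · have h := (warpedProductMetric g₁ g₂ f hf hpos).two_mul_inner_nabla
      (mdifferentiableAt_liftLeft hX) (mdifferentiableAt_liftRight hY)
      (mdifferentiableAt_liftRight hW)
    simp only [PseudoRiemannianMetric.koszul, warpedProductMetric_inner_liftRight,
      warpedProductMetric_inner_liftLeft_liftRight, warpedProductMetric_inner_liftRight_liftLeft,
      mlieBracket_liftRight hY hW, mlieBracket_liftLeft_liftRight hX hY,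
      mlieBracket_liftRight_liftLeft hX hW,
      mvfderiv_mul_comp_prod hfz2 (g₂.mdifferentiableAt_inner hY hW),
      mvfderiv_comp_snd_liftLeft (g₂.mdifferentiableAt_inner hY hW),
      mvfderiv_comp_fst_liftLeft hfz2, mvfderiv_sq hfz,
      warpedProductMetric_val_liftLeft_liftRight] at h ⊢
    simp at h ⊢
    have := (hpos z.1).ne'
    field_simp
    linarith

/-- `∇_X Y = (Y f / f) X` for lifts of `X` from the fibre and `Y` from the base. -/
lemma warpedProductMetric_nabla_liftRight_liftLeft (X : Π q : M₂, TangentSpace I₂ q)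
    {Y : Π p : M₁, TangentSpace I₁ p} (hY : MDiffAt (T% Y) z.1) :
    (warpedProductMetric g₁ g₂ f hf hpos).nabla (liftRight I₁ M₁ I₂ X) (liftLeft I₁ I₂ M₂ Y) z =
      (mvfderiv I₁ f z.1 (Y z.1) / f z.1) • liftRight I₁ M₁ I₂ X z := by
  wlog hX : MDiffAt (T% X) z.2 generalizing X
  · have h := this (extend E₂ (X z.2)) (mdifferentiableAt_extend ..)
    have e : liftRight I₁ M₁ I₂ (extend E₂ (X z.2)) z = liftRight I₁ M₁ I₂ X z := by
      simp only [liftRight, extend_apply_self]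
    rwa [(warpedProductMetric g₁ g₂ f hf hpos).nabla_congr_left e, e] at h
  rw [← warpedProductMetric_nabla_liftLeft_liftRight g₁ g₂ hf hpos Y hX, ← sub_eq_zero,
    PseudoRiemannianMetric.nabla_sub_nabla _ (mdifferentiableAt_liftRight hX)
      (mdifferentiableAt_liftLeft hY), mlieBracket_liftRight_liftLeft hY hX]

/-- `∇_X Y = ∇²_X Y - f g₂(X, Y) grad f` for lifts of vector fields on the fibre. -/
lemma warpedProductMetric_nabla_liftRight_liftRight (X : Π q : M₂, TangentSpace I₂ q)
    {Y : Π q : M₂, TangentSpace I₂ q} (hY : MDiffAt (T% Y) z.2) :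
    (warpedProductMetric g₁ g₂ f hf hpos).nabla
      (liftRight I₁ M₁ I₂ X) (liftRight I₁ M₁ I₂ Y) z =
      liftRight I₁ M₁ I₂ (g₂.nabla X Y) z -
        (f z.1 * g₂.inner X Y z.2) • liftLeft I₁ I₂ M₂ (g₁.gradient f) z := by
  wlog hX : MDiffAt (T% X) z.2 generalizing X
  · have h := this (extend E₂ (X z.2)) (mdifferentiableAt_extend ..)
    have e : liftRight I₁ M₁ I₂ (extend E₂ (X z.2)) z = liftRight I₁ M₁ I₂ X z := by
      simp only [liftRight, extend_apply_self]
    rw [(warpedProductMetric g₁ g₂ f hf hpos).nabla_congr_left e] at h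
    rw [h]
    simp only [liftRight, PseudoRiemannianMetric.nabla, PseudoRiemannianMetric.inner,
      extend_apply_self]
  have hfz : MDiffAt f z.1 := (hf z.1).mdifferentiableAt (by simp)
  have hfz2 : MDiffAt (fun p ↦ f p ^ 2) z.1 := ((hf.pow 2) z.1).mdifferentiableAt (by simp)
  refine warpedProductMetric_ext g₁ g₂ hf hpos
    (V' := liftRight I₁ M₁ I₂ (g₂.nabla X Y) +
      (fun _ : M₁ × M₂ ↦ -(f z.1 * g₂.inner X Y z.2)) • liftLeft I₁ I₂ M₂ (g₁.gradient f))
    (fun W hW ↦ ?_) (fun W hW ↦ ?_) |>.trans ?_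
  · rw [PseudoRiemannianMetric.inner_add_left, PseudoRiemannianMetric.inner_smul_left]
    have h := (warpedProductMetric g₁ g₂ f hf hpos).two_mul_inner_nabla
      (mdifferentiableAt_liftRight hX) (mdifferentiableAt_liftRight hY)
      (mdifferentiableAt_liftLeft hW)
    simp only [PseudoRiemannianMetric.koszul, warpedProductMetric_inner_liftRight,
      warpedProductMetric_inner_liftLeft, warpedProductMetric_val_liftLeft_liftRight,
      warpedProductMetric_inner_liftLeft_liftRight, warpedProductMetric_inner_liftRight_liftLeft,
      mlieBracket_liftRight hX hY, mlieBracket_liftLeft_liftRight hW hX,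
      mlieBracket_liftRight_liftLeft hW hY,
      mvfderiv_mul_comp_prod hfz2 (g₂.mdifferentiableAt_inner hX hY),
      mvfderiv_comp_snd_liftLeft (g₂.mdifferentiableAt_inner hX hY),
      mvfderiv_comp_fst_liftLeft hfz2, mvfderiv_sq hfz] at h ⊢
    have hg : g₁.inner (g₁.gradient f) W z.1 = mvfderiv I₁ f z.1 (W z.1) := g₁.val_gradient f _ _
    simp [hg] at h ⊢
    linarith
  · rw [PseudoRiemannianMetric.inner_add_left, PseudoRiemannianMetric.inner_smul_left]
    have h := (warpedProductMetric g₁ g₂ f hf hpos).two_mul_inner_nabla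
      (mdifferentiableAt_liftRight hX) (mdifferentiableAt_liftRight hY)
      (mdifferentiableAt_liftRight hW)
    have h' := g₂.two_mul_inner_nabla hX hY hW
    simp only [PseudoRiemannianMetric.koszul, warpedProductMetric_inner_liftRight,
      warpedProductMetric_inner_liftLeft_liftRight, warpedProductMetric_val_liftRight_liftRight,
      mlieBracket_liftRight hX hY, mlieBracket_liftRight hY hW, mlieBracket_liftRight hW hX,
      mvfderiv_mul_comp_prod hfz2 (g₂.mdifferentiableAt_inner hX hY),
      mvfderiv_mul_comp_prod hfz2 (g₂.mdifferentiableAt_inner hY hW),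
      mvfderiv_mul_comp_prod hfz2 (g₂.mdifferentiableAt_inner hW hX),
      mvfderiv_comp_snd_liftRight (g₂.mdifferentiableAt_inner hX hY),
      mvfderiv_comp_snd_liftRight (g₂.mdifferentiableAt_inner hY hW),
      mvfderiv_comp_snd_liftRight (g₂.mdifferentiableAt_inner hW hX),
      mvfderiv_comp_fst_liftRight hfz2] at h h' ⊢
    simp at h h' ⊢
    linear_combination (1 / 2) * h - (1 / 2) * f z.1 ^ 2 * h'
  · simp [sub_eq_add_neg]

end WarpedNabla

section WarpedCurvature

variable {E₁ : Type*} [NormedAddCommGroup E₁] [NormedSpace ℝ E₁]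
  {H₁ : Type*} [TopologicalSpace H₁] {I₁ : ModelWithCorners ℝ E₁ H₁}
  {M₁ : Type*} [TopologicalSpace M₁] [ChartedSpace H₁ M₁] [IsManifold I₁ ∞ M₁]
  {E₂ : Type*} [NormedAddCommGroup E₂] [NormedSpace ℝ E₂]
  {H₂ : Type*} [TopologicalSpace H₂] {I₂ : ModelWithCorners ℝ E₂ H₂}
  {M₂ : Type*} [TopologicalSpace M₂] [ChartedSpace H₂ M₂] [IsManifold I₂ ∞ M₂]
  (g₁ : PseudoRiemannianMetric I₁ M₁) (g₂ : PseudoRiemannianMetric I₂ M₂)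
  {f : M₁ → ℝ} (hf : ContMDiff I₁ 𝓘(ℝ) ∞ f) (hpos : ∀ p, 0 < f p) {z : M₁ × M₂}
  {X₁ Y₁ Z₁ : Π p : M₁, TangentSpace I₁ p} {X₂ Y₂ Z₂ : Π q : M₂, TangentSpace I₂ q}

lemma mdifferentiableAt_mvfderiv_div (hf : ContMDiff I₁ 𝓘(ℝ) ∞ f) (hpos : ∀ p, 0 < f p)
    (hX : ContMDiff I₁ I₁.tangent ∞ (T% X₁)) (p : M₁) :
    MDiffAt (fun p ↦ mvfderiv I₁ f p (X₁ p) / f p) p :=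
  (mdifferentiableAt_mvfderiv_apply (hf p) ((hX p).mdifferentiableAt (by simp))).div
    ((hf p).mdifferentiableAt (by simp)) (hpos p).ne'

/-- The quotient rule for `(X f) / f`. -/
lemma mvfderiv_mvfderiv_div (hf : ContMDiff I₁ 𝓘(ℝ) ∞ f) (hpos : ∀ p, 0 < f p)
    (hX : ContMDiff I₁ I₁.tangent ∞ (T% X₁)) (p : M₁) (v : TangentSpace I₁ p) :
    mvfderiv I₁ (fun p ↦ mvfderiv I₁ f p (X₁ p) / f p) p v =
      mvfderiv I₁ (fun p ↦ mvfderiv I₁ f p (X₁ p)) p v / f p -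
        mvfderiv I₁ f p (X₁ p) / f p * (mvfderiv I₁ f p v / f p) := by
  have h := mvfderiv_mul (mdifferentiableAt_mvfderiv_div hf hpos hX p)
    ((hf p).mdifferentiableAt (by simp))
  have e : (fun p ↦ mvfderiv I₁ f p (X₁ p) / f p) * f = fun p ↦ mvfderiv I₁ f p (X₁ p) := by
    ext p
    exact div_mul_cancel₀ _ (hpos p).ne'
  rw [e] at h
  have hp := (hpos p).ne'
  rw [h]
  simp
  field_simp
  ring

variable [FiniteDimensional ℝ E₁] [FiniteDimensional ℝ E₂]

lemma nabla_liftLeft_liftLeft_eq (hY : ContMDiff I₁ I₁.tangent ∞ (T% Y₁)) :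
    (warpedProductMetric g₁ g₂ f hf hpos).nabla (liftLeft I₁ I₂ M₂ X₁) (liftLeft I₁ I₂ M₂ Y₁) =
      liftLeft I₁ I₂ M₂ (g₁.nabla X₁ Y₁) := funext fun _ ↦
  warpedProductMetric_nabla_liftLeft_liftLeft g₁ g₂ hf hpos X₁
    ((hY _).mdifferentiableAt (by simp))

lemma nabla_liftLeft_liftRight_eq (hY : ContMDiff I₂ I₂.tangent ∞ (T% Y₂)) :
    (warpedProductMetric g₁ g₂ f hf hpos).nabla (liftLeft I₁ I₂ M₂ X₁) (liftRight I₁ M₁ I₂ Y₂) =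
      ((fun p ↦ mvfderiv I₁ f p (X₁ p) / f p) ∘ (Prod.fst : M₁ × M₂ → M₁)) • liftRight I₁ M₁ I₂ Y₂ :=
  funext fun _ ↦ warpedProductMetric_nabla_liftLeft_liftRight g₁ g₂ hf hpos X₁
    ((hY _).mdifferentiableAt (by simp))

lemma nabla_liftRight_liftLeft_eq (hY : ContMDiff I₁ I₁.tangent ∞ (T% Y₁)) :
    (warpedProductMetric g₁ g₂ f hf hpos).nabla (liftRight I₁ M₁ I₂ X₂) (liftLeft I₁ I₂ M₂ Y₁) =
      ((fun p ↦ mvfderiv I₁ f p (Y₁ p) / f p) ∘ (Prod.fst : M₁ × M₂ → M₁)) • liftRight I₁ M₁ I₂ X₂ :=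
  funext fun _ ↦ warpedProductMetric_nabla_liftRight_liftLeft g₁ g₂ hf hpos X₂
    ((hY _).mdifferentiableAt (by simp))

lemma nabla_liftRight_liftRight_eq (hY : ContMDiff I₂ I₂.tangent ∞ (T% Y₂)) :
    (warpedProductMetric g₁ g₂ f hf hpos).nabla (liftRight I₁ M₁ I₂ X₂) (liftRight I₁ M₁ I₂ Y₂) =
      liftRight I₁ M₁ I₂ (g₂.nabla X₂ Y₂) -
        ((f ∘ (Prod.fst : M₁ × M₂ → M₁)) * (g₂.inner X₂ Y₂ ∘ Prod.snd)) • liftLeft I₁ I₂ M₂ (g₁.gradient f) :=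
  funext fun _ ↦ warpedProductMetric_nabla_liftRight_liftRight g₁ g₂ hf hpos X₂
    ((hY _).mdifferentiableAt (by simp))

/-- The Hessian as a second-order operator: `H^f(Y, Z) = Y (Z f) - (∇_Y Z) f`. -/
lemma hessian_eq (hf : ContMDiff I₁ 𝓘(ℝ) ∞ f) (hY : ContMDiff I₁ I₁.tangent ∞ (T% Y₁))
    (hZ : ContMDiff I₁ I₁.tangent ∞ (T% Z₁)) (p : M₁) :
    g₁.hessian f Y₁ Z₁ p = mvfderiv I₁ (fun p ↦ mvfderiv I₁ f p (Z₁ p)) p (Y₁ p) -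
      mvfderiv I₁ f p (g₁.nabla Y₁ Z₁ p) := by
  have h := g₁.mvfderiv_inner ((hY p).mdifferentiableAt (by simp))
    ((g₁.contMDiff_gradient hf p).mdifferentiableAt (by simp)) ((hZ p).mdifferentiableAt (by simp))
  have e (W : Π p : M₁, TangentSpace I₁ p) :
      g₁.inner (g₁.gradient f) W = fun p ↦ mvfderiv I₁ f p (W p) :=
    funext fun p ↦ g₁.val_gradient f p _
  rw [e, e] at h
  rw [PseudoRiemannianMetric.hessian, h]
  ring

theorem curvature_liftLeft_liftLeft_liftLeft (hX : ContMDiff I₁ I₁.tangent ∞ (T% X₁))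
    (hY : ContMDiff I₁ I₁.tangent ∞ (T% Y₁)) (hZ : ContMDiff I₁ I₁.tangent ∞ (T% Z₁)) :
    (warpedProductMetric g₁ g₂ f hf hpos).curvature
      (liftLeft I₁ I₂ M₂ X₁) (liftLeft I₁ I₂ M₂ Y₁) (liftLeft I₁ I₂ M₂ Z₁) z =
      liftLeft I₁ I₂ M₂ (g₁.curvature X₁ Y₁ Z₁) z := by
  simp only [PseudoRiemannianMetric.curvature, Pi.add_apply, Pi.sub_apply]
  rw [nabla_liftLeft_liftLeft_eq g₁ g₂ hf hpos hZ, nabla_liftLeft_liftLeft_eq g₁ g₂ hf hpos hZ,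
    nabla_liftLeft_liftLeft_eq g₁ g₂ hf hpos (g₁.contMDiff_nabla hX hZ),
    nabla_liftLeft_liftLeft_eq g₁ g₂ hf hpos (g₁.contMDiff_nabla hY hZ),
    PseudoRiemannianMetric.nabla_congr_left (X' := liftLeft I₁ I₂ M₂ (mlieBracket I₁ X₁ Y₁)) _
      (mlieBracket_liftLeft ((hX _).mdifferentiableAt (by simp))
        ((hY _).mdifferentiableAt (by simp))),
    nabla_liftLeft_liftLeft_eq g₁ g₂ hf hpos hZ]
  simp only [liftLeft, Pi.add_apply, Pi.sub_apply, map_add, map_sub]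

theorem curvature_liftRight_liftLeft_liftLeft (hX : ContMDiff I₂ I₂.tangent ∞ (T% X₂))
    (hY : ContMDiff I₁ I₁.tangent ∞ (T% Y₁)) (hZ : ContMDiff I₁ I₁.tangent ∞ (T% Z₁)) :
    (warpedProductMetric g₁ g₂ f hf hpos).curvature
      (liftRight I₁ M₁ I₂ X₂) (liftLeft I₁ I₂ M₂ Y₁) (liftLeft I₁ I₂ M₂ Z₁) z =
      (1 / f z.1 * g₁.hessian f Y₁ Z₁ z.1) • liftRight I₁ M₁ I₂ X₂ z := by
  have hXz : MDiffAt (T% X₂) z.2 := (hX _).mdifferentiableAt (by simp)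
  have hYz : MDiffAt (T% Y₁) z.1 := (hY _).mdifferentiableAt (by simp)
  have hd := mdifferentiableAt_mvfderiv_div hf hpos hZ z.1
  simp only [PseudoRiemannianMetric.curvature, Pi.add_apply, Pi.sub_apply]
  rw [nabla_liftRight_liftLeft_eq g₁ g₂ hf hpos hZ, nabla_liftLeft_liftLeft_eq g₁ g₂ hf hpos hZ,
    nabla_liftRight_liftLeft_eq g₁ g₂ hf hpos (g₁.contMDiff_nabla hY hZ),
    PseudoRiemannianMetric.nabla_smul _ (mdifferentiableAt_liftRight hXz)
      (hd.comp z mdifferentiableAt_fst),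
    nabla_liftLeft_liftRight_eq g₁ g₂ hf hpos hX, mvfderiv_comp_fst_liftLeft hd,
    mvfderiv_mvfderiv_div hf hpos hZ,
    PseudoRiemannianMetric.nabla_congr_left (X' := 0) _ (mlieBracket_liftRight_liftLeft hYz hXz),
    hessian_eq g₁ hf hY hZ]
  have h0 (W) : (warpedProductMetric g₁ g₂ f hf hpos).nabla 0 W z = 0 := by
    simp [PseudoRiemannianMetric.nabla]
  rw [h0]
  simp only [Pi.smul_apply', Function.comp_apply]
  module

theorem curvature_liftLeft_liftRight_liftRight (hX : ContMDiff I₁ I₁.tangent ∞ (T% X₁))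
    (hY : ContMDiff I₂ I₂.tangent ∞ (T% Y₂)) (hZ : ContMDiff I₂ I₂.tangent ∞ (T% Z₂)) :
    (warpedProductMetric g₁ g₂ f hf hpos).curvature
      (liftLeft I₁ I₂ M₂ X₁) (liftRight I₁ M₁ I₂ Y₂) (liftRight I₁ M₁ I₂ Z₂) z =
      (f z.1 * g₂.inner Y₂ Z₂ z.2) •
        liftLeft I₁ I₂ M₂ (g₁.nabla X₁ (g₁.gradient f)) z := by
  have hXz : MDiffAt (T% X₁) z.1 := (hX _).mdifferentiableAt (by simp)
  have hYz : MDiffAt (T% Y₂) z.2 := (hY _).mdifferentiableAt (by simp)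
  have hZz : MDiffAt (T% Z₂) z.2 := (hZ _).mdifferentiableAt (by simp)
  have hfz : MDiffAt f z.1 := (hf z.1).mdifferentiableAt (by simp)
  have hgrad := g₁.contMDiff_gradient hf
  have hn := g₂.contMDiff_nabla hY hZ
  have hi := g₂.mdifferentiableAt_inner hYz hZz
  have hd := mdifferentiableAt_mvfderiv_div hf hpos hX z.1
  have hfi : MDiffAt (((f ∘ Prod.fst) * (g₂.inner Y₂ Z₂ ∘ Prod.snd) : M₁ × M₂ → ℝ)) z :=
    (hfz.comp z mdifferentiableAt_fst).mul (hi.comp z mdifferentiableAt_snd)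
  have hLg := mdifferentiableAt_liftLeft (I₂ := I₂) (z := z)
    ((hgrad z.1).mdifferentiableAt (by simp))
  simp only [PseudoRiemannianMetric.curvature, Pi.add_apply, Pi.sub_apply]
  rw [nabla_liftLeft_liftRight_eq g₁ g₂ hf hpos hZ, nabla_liftRight_liftRight_eq g₁ g₂ hf hpos hZ,
    PseudoRiemannianMetric.nabla_sub _
      (mdifferentiableAt_liftRight ((hn _).mdifferentiableAt (by simp)))
      (hfi.smul_section hLg),
    PseudoRiemannianMetric.nabla_smul _ (mdifferentiableAt_liftRight hZz)
      (hd.comp z mdifferentiableAt_fst),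
    PseudoRiemannianMetric.nabla_smul _ hLg hfi,
    nabla_liftRight_liftRight_eq g₁ g₂ hf hpos hZ, nabla_liftLeft_liftRight_eq g₁ g₂ hf hpos hn,
    nabla_liftLeft_liftLeft_eq g₁ g₂ hf hpos hgrad,
    mvfderiv_comp_fst_liftRight hd, mvfderiv_mul_comp_prod hfz hi,
    mvfderiv_comp_fst_liftLeft hfz, mvfderiv_comp_snd_liftLeft hi,
    PseudoRiemannianMetric.nabla_congr_left (X' := 0) _ (mlieBracket_liftLeft_liftRight hXz hYz)]
  have h0 (W) : (warpedProductMetric g₁ g₂ f hf hpos).nabla 0 W z = 0 := by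
    simp [PseudoRiemannianMetric.nabla]
  rw [h0]
  simp only [Pi.smul_apply', Pi.sub_apply, Pi.mul_apply, Function.comp_apply]
  have e : g₂.inner Y₂ Z₂ z.2 * mvfderiv I₁ f z.1 (X₁ z.1) =
      mvfderiv I₁ f z.1 (X₁ z.1) / f z.1 * (f z.1 * g₂.inner Y₂ Z₂ z.2) := by
    have := (hpos z.1).ne'
    field_simp
  rw [e]
  module

theorem curvature_liftRight_liftRight_liftRight (hX : ContMDiff I₂ I₂.tangent ∞ (T% X₂))
    (hY : ContMDiff I₂ I₂.tangent ∞ (T% Y₂)) (hZ : ContMDiff I₂ I₂.tangent ∞ (T% Z₂)) :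
    (warpedProductMetric g₁ g₂ f hf hpos).curvature
      (liftRight I₁ M₁ I₂ X₂) (liftRight I₁ M₁ I₂ Y₂) (liftRight I₁ M₁ I₂ Z₂) z =
      liftRight I₁ M₁ I₂ (g₂.curvature X₂ Y₂ Z₂) z -
        g₁.inner (g₁.gradient f) (g₁.gradient f) z.1 •
          (g₂.inner X₂ Z₂ z.2 • liftRight I₁ M₁ I₂ Y₂ z -
            g₂.inner Y₂ Z₂ z.2 • liftRight I₁ M₁ I₂ X₂ z) := by
  have hXz : MDiffAt (T% X₂) z.2 := (hX _).mdifferentiableAt (by simp)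
  have hYz : MDiffAt (T% Y₂) z.2 := (hY _).mdifferentiableAt (by simp)
  have hZz : MDiffAt (T% Z₂) z.2 := (hZ _).mdifferentiableAt (by simp)
  have hfz : MDiffAt f z.1 := (hf z.1).mdifferentiableAt (by simp)
  have hgrad := g₁.contMDiff_gradient hf
  have hLg := mdifferentiableAt_liftLeft (I₂ := I₂) (z := z)
    ((hgrad z.1).mdifferentiableAt (by simp))
  have hgg : g₁.inner (g₁.gradient f) (g₁.gradient f) z.1 =
      mvfderiv I₁ f z.1 (g₁.gradient f z.1) := g₁.val_gradient f _ _
  have key {U V : Π q : M₂, TangentSpace I₂ q} (hU : ContMDiff I₂ I₂.tangent ∞ (T% U))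
      (hV : ContMDiff I₂ I₂.tangent ∞ (T% V)) :
      (warpedProductMetric g₁ g₂ f hf hpos).nabla (liftRight I₁ M₁ I₂ V)
        ((warpedProductMetric g₁ g₂ f hf hpos).nabla
          (liftRight I₁ M₁ I₂ U) (liftRight I₁ M₁ I₂ Z₂)) z =
      liftRight I₁ M₁ I₂ (g₂.nabla V (g₂.nabla U Z₂)) z -
        (g₁.inner (g₁.gradient f) (g₁.gradient f) z.1 * g₂.inner U Z₂ z.2) •
          liftRight I₁ M₁ I₂ V z -
        (f z.1 * (g₂.inner V (g₂.nabla U Z₂) z.2 + g₂.inner (g₂.nabla V U) Z₂ z.2 +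
          g₂.inner U (g₂.nabla V Z₂) z.2)) • liftLeft I₁ I₂ M₂ (g₁.gradient f) z := by
    have hUz : MDiffAt (T% U) z.2 := (hU _).mdifferentiableAt (by simp)
    have hVz : MDiffAt (T% V) z.2 := (hV _).mdifferentiableAt (by simp)
    have hn := g₂.contMDiff_nabla hU hZ
    have hi := g₂.mdifferentiableAt_inner hUz hZz
    have hfi : MDiffAt (((f ∘ Prod.fst) * (g₂.inner U Z₂ ∘ Prod.snd) : M₁ × M₂ → ℝ)) z :=
      (hfz.comp z mdifferentiableAt_fst).mul (hi.comp z mdifferentiableAt_snd)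
    rw [nabla_liftRight_liftRight_eq g₁ g₂ hf hpos hZ,
      PseudoRiemannianMetric.nabla_sub _
        (mdifferentiableAt_liftRight ((hn _).mdifferentiableAt (by simp)))
        (hfi.smul_section hLg),
      PseudoRiemannianMetric.nabla_smul _ hLg hfi,
      nabla_liftRight_liftRight_eq g₁ g₂ hf hpos hn,
      nabla_liftRight_liftLeft_eq g₁ g₂ hf hpos hgrad, mvfderiv_mul_comp_prod hfz hi,
      mvfderiv_comp_fst_liftRight hfz, mvfderiv_comp_snd_liftRight hi,
      g₂.mvfderiv_inner hVz hUz hZz, hgg]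
    simp only [Pi.smul_apply', Pi.sub_apply, Pi.mul_apply, Function.comp_apply]
    have e : (f z.1 * g₂.inner U Z₂ z.2) • (mvfderiv I₁ f z.1 (g₁.gradient f z.1) / f z.1) •
        liftRight I₁ M₁ I₂ V z = (mvfderiv I₁ f z.1 (g₁.gradient f z.1) * g₂.inner U Z₂ z.2) •
          liftRight I₁ M₁ I₂ V z := by
      have := (hpos z.1).ne'
      rw [smul_smul]
      congr 1
      field_simp
    rw [e]
    module
  simp only [PseudoRiemannianMetric.curvature, Pi.add_apply, Pi.sub_apply]
  rw [key hX hY, key hY hX,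
    PseudoRiemannianMetric.nabla_congr_left (X' := liftRight I₁ M₁ I₂ (mlieBracket I₂ X₂ Y₂)) _
      (mlieBracket_liftRight hXz hYz),
    nabla_liftRight_liftRight_eq g₁ g₂ hf hpos hZ]
  have ht : g₂.inner (mlieBracket I₂ X₂ Y₂) Z₂ z.2 =
      g₂.inner (g₂.nabla X₂ Y₂) Z₂ z.2 - g₂.inner (g₂.nabla Y₂ X₂) Z₂ z.2 := by
    simp only [PseudoRiemannianMetric.inner]
    rw [← g₂.nabla_sub_nabla hXz hYz, map_sub, sub_apply]
  have hadd : liftRight I₁ M₁ I₂ (g₂.nabla Y₂ (g₂.nabla X₂ Z₂) - g₂.nabla X₂ (g₂.nabla Y₂ Z₂) +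
      g₂.nabla (mlieBracket I₂ X₂ Y₂) Z₂) z =
      liftRight I₁ M₁ I₂ (g₂.nabla Y₂ (g₂.nabla X₂ Z₂)) z -
        liftRight I₁ M₁ I₂ (g₂.nabla X₂ (g₂.nabla Y₂ Z₂)) z +
        liftRight I₁ M₁ I₂ (g₂.nabla (mlieBracket I₂ X₂ Y₂) Z₂) z := by
    simp only [liftRight, Pi.add_apply, Pi.sub_apply, map_add, map_sub]
  rw [hadd]
  simp only [Pi.smul_apply', Pi.sub_apply, Pi.mul_apply, Function.comp_apply]
  rw [ht]
  module

theorem curvature_liftLeft_liftLeft_liftRight (hX : ContMDiff I₁ I₁.tangent ∞ (T% X₁))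
    (hY : ContMDiff I₁ I₁.tangent ∞ (T% Y₁)) (hZ : ContMDiff I₂ I₂.tangent ∞ (T% Z₂)) :
    (warpedProductMetric g₁ g₂ f hf hpos).curvature
      (liftLeft I₁ I₂ M₂ X₁) (liftLeft I₁ I₂ M₂ Y₁) (liftRight I₁ M₁ I₂ Z₂) z = 0 := by
  have hXz : MDiffAt (T% X₁) z.1 := (hX _).mdifferentiableAt (by simp)
  have hYz : MDiffAt (T% Y₁) z.1 := (hY _).mdifferentiableAt (by simp)
  have hZz : MDiffAt (T% Z₂) z.2 := (hZ _).mdifferentiableAt (by simp)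
  have hdX := mdifferentiableAt_mvfderiv_div hf hpos hX z.1
  have hdY := mdifferentiableAt_mvfderiv_div hf hpos hY z.1
  have : CompleteSpace E₁ := FiniteDimensional.complete ℝ E₁
  simp only [PseudoRiemannianMetric.curvature, Pi.add_apply, Pi.sub_apply]
  rw [nabla_liftLeft_liftRight_eq g₁ g₂ hf hpos hZ, nabla_liftLeft_liftRight_eq g₁ g₂ hf hpos hZ,
    PseudoRiemannianMetric.nabla_smul _ (mdifferentiableAt_liftRight hZz)
      (hdX.comp z mdifferentiableAt_fst),
    PseudoRiemannianMetric.nabla_smul _ (mdifferentiableAt_liftRight hZz)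
      (hdY.comp z mdifferentiableAt_fst),
    PseudoRiemannianMetric.nabla_congr_left (X' := liftLeft I₁ I₂ M₂ (mlieBracket I₁ X₁ Y₁)) _
      (mlieBracket_liftLeft hXz hYz),
    nabla_liftLeft_liftRight_eq g₁ g₂ hf hpos hZ, nabla_liftLeft_liftRight_eq g₁ g₂ hf hpos hZ,
    nabla_liftLeft_liftRight_eq g₁ g₂ hf hpos hZ, mvfderiv_comp_fst_liftLeft hdX,
    mvfderiv_comp_fst_liftLeft hdY, mvfderiv_mvfderiv_div hf hpos hX,
    mvfderiv_mvfderiv_div hf hpos hY]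
  simp only [Pi.smul_apply', Function.comp_apply]
  rw [mvfderiv_mlieBracket (hf z.1) hXz hYz]
  module

theorem curvature_liftRight_liftRight_liftLeft (hX : ContMDiff I₂ I₂.tangent ∞ (T% X₂))
    (hY : ContMDiff I₂ I₂.tangent ∞ (T% Y₂)) (hZ : ContMDiff I₁ I₁.tangent ∞ (T% Z₁)) :
    (warpedProductMetric g₁ g₂ f hf hpos).curvature
      (liftRight I₁ M₁ I₂ X₂) (liftRight I₁ M₁ I₂ Y₂) (liftLeft I₁ I₂ M₂ Z₁) z = 0 := by
  have hXz : MDiffAt (T% X₂) z.2 := (hX _).mdifferentiableAt (by simp)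
  have hYz : MDiffAt (T% Y₂) z.2 := (hY _).mdifferentiableAt (by simp)
  have hd := mdifferentiableAt_mvfderiv_div hf hpos hZ z.1
  have ht := PseudoRiemannianMetric.nabla_sub_nabla (warpedProductMetric g₁ g₂ f hf hpos)
    (mdifferentiableAt_liftRight (I₁ := I₁) (z := z) hXz) (mdifferentiableAt_liftRight hYz)
  simp only [PseudoRiemannianMetric.curvature, Pi.add_apply, Pi.sub_apply]
  rw [nabla_liftRight_liftLeft_eq g₁ g₂ hf hpos hZ, nabla_liftRight_liftLeft_eq g₁ g₂ hf hpos hZ,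
    PseudoRiemannianMetric.nabla_smul _ (mdifferentiableAt_liftRight hXz)
      (hd.comp z mdifferentiableAt_fst),
    PseudoRiemannianMetric.nabla_smul _ (mdifferentiableAt_liftRight hYz)
      (hd.comp z mdifferentiableAt_fst),
    mvfderiv_comp_fst_liftRight hd, mvfderiv_comp_fst_liftRight hd,
    PseudoRiemannianMetric.nabla_congr_left (X' := liftRight I₁ M₁ I₂ (mlieBracket I₂ X₂ Y₂)) _
      (mlieBracket_liftRight hXz hYz), nabla_liftRight_liftLeft_eq g₁ g₂ hf hpos hZ]
  simp only [Pi.smul_apply', Function.comp_apply]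
  rw [← mlieBracket_liftRight hXz hYz, ← ht]
  module

end WarpedCurvature

theorem mainTheorem2
    {E₁ : Type*} [NormedAddCommGroup E₁] [NormedSpace ℝ E₁] [FiniteDimensional ℝ E₁]
    {H₁ : Type*} [TopologicalSpace H₁] (I₁ : ModelWithCorners ℝ E₁ H₁)
    (M₁ : Type*) [TopologicalSpace M₁] [ChartedSpace H₁ M₁] [IsManifold I₁ ∞ M₁]
    [BoundarylessManifold I₁ M₁]
    {E₂ : Type*} [NormedAddCommGroup E₂] [NormedSpace ℝ E₂] [FiniteDimensional ℝ E₂]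
    {H₂ : Type*} [TopologicalSpace H₂] (I₂ : ModelWithCorners ℝ E₂ H₂)
    (M₂ : Type*) [TopologicalSpace M₂] [ChartedSpace H₂ M₂] [IsManifold I₂ ∞ M₂]
    [BoundarylessManifold I₂ M₂]
    (g₁ : PseudoRiemannianMetric I₁ M₁) (g₂ : PseudoRiemannianMetric I₂ M₂)
    (f : M₁ → ℝ) (hf : ContMDiff I₁ 𝓘(ℝ) ∞ f) (hpos : ∀ p, 0 < f p)
    (n : ℕ) (hn : n = Module.finrank ℝ E₁ + Module.finrank ℝ E₂) (hn2 : 2 ≤ n)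
    (X₁ Y₁ Z₁ : SmoothVectorField I₁ M₁) (X₂ Y₂ Z₂ : SmoothVectorField I₂ M₂)
    (p : M₁) (q : M₂) :
    let g : PseudoRiemannianMetric (I₁.prod I₂) (M₁ × M₂) := warpedProductMetric g₁ g₂ f hf hpos
    let κ : ℝ := g.scalarCurvature (p, q) / ((n : ℝ) * ((n : ℝ) - 1))
    let L : (Π p : M₁, TangentSpace I₁ p) → Π z : M₁ × M₂, TangentSpace (I₁.prod I₂) z :=
      liftLeft I₁ I₂ M₂
    let R : (Π q : M₂, TangentSpace I₂ q) → Π z : M₁ × M₂, TangentSpace (I₁.prod I₂) z :=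
      liftRight I₁ M₁ I₂
    g.concircular (L X₁) (L Y₁) (L Z₁) (p, q) =
        L (g₁.curvature X₁ Y₁ Z₁) (p, q)
          - κ • (g₁.inner X₁ Z₁ p • L Y₁ (p, q) - g₁.inner Y₁ Z₁ p • L X₁ (p, q))
    ∧ g.concircular (R X₂) (L Y₁) (L Z₁) (p, q) =
        (1 / f p * g₁.hessian f Y₁ Z₁ p + κ * g₁.inner Y₁ Z₁ p) • R X₂ (p, q)
    ∧ g.concircular (L X₁) (R Y₂) (R Z₂) (p, q) =
        (f p * g₂.inner Y₂ Z₂ q) •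
          (L (g₁.nabla X₁ (g₁.gradient f)) (p, q) + (κ * f p) • L X₁ (p, q))
    ∧ g.concircular (R X₂) (R Y₂) (R Z₂) (p, q) =
        R (g₂.curvature X₂ Y₂ Z₂) (p, q)
          - (g₁.inner (g₁.gradient f) (g₁.gradient f) p + κ * f p ^ 2) •
            (g₂.inner X₂ Z₂ q • R Y₂ (p, q) - g₂.inner Y₂ Z₂ q • R X₂ (p, q))
    ∧ g.concircular (L X₁) (L Y₁) (R Z₂) (p, q) = 0
    ∧ g.concircular (R X₂) (R Y₂) (L Z₁) (p, q) = 0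
    ∧ g.concircular (L Y₁) (R X₂) (L Z₁) (p, q) =
        -((1 / f p * g₁.hessian f Y₁ Z₁ p + κ * g₁.inner Y₁ Z₁ p) • R X₂ (p, q))
    ∧ g.concircular (R Y₂) (L X₁) (R Z₂) (p, q) =
        -((f p * g₂.inner Y₂ Z₂ q) •
          (L (g₁.nabla X₁ (g₁.gradient f)) (p, q) + (κ * f p) • L X₁ (p, q))) := by
  intro g κ L R
  have hX₁ := X₁.contMDiff
  have hY₁ := Y₁.contMDiff
  have hZ₁ := Z₁.contMDiff
  have hX₂ := X₂.contMDiff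
  have hY₂ := Y₂.contMDiff
  have hZ₂ := Z₂.contMDiff
  have hC (U V W : Π z : M₁ × M₂, TangentSpace (I₁.prod I₂) z) : g.concircular U V W (p, q) =
      g.curvature U V W (p, q) -
        κ • (g.inner U W (p, q) • V (p, q) - g.inner V W (p, q) • U (p, q)) := by
    simp only [PseudoRiemannianMetric.concircular, κ, Module.finrank_prod, ← hn]
  have hLL (U V : Π p : M₁, TangentSpace I₁ p) : g.inner (L U) (L V) (p, q) = g₁.inner U V p :=
    warpedProductMetric_val_liftLeft_liftLeft g₁ g₂ hf hpos U V
  have hRR (U V : Π q : M₂, TangentSpace I₂ q) :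
      g.inner (R U) (R V) (p, q) = f p ^ 2 * g₂.inner U V q :=
    warpedProductMetric_val_liftRight_liftRight g₁ g₂ hf hpos U V
  have hLR (U : Π p : M₁, TangentSpace I₁ p) (V : Π q : M₂, TangentSpace I₂ q) :
      g.inner (L U) (R V) (p, q) = 0 :=
    warpedProductMetric_val_liftLeft_liftRight g₁ g₂ hf hpos U V
  have hRL (U : Π p : M₁, TangentSpace I₁ p) (V : Π q : M₂, TangentSpace I₂ q) :
      g.inner (R V) (L U) (p, q) = 0 :=
    warpedProductMetric_val_liftRight_liftLeft g₁ g₂ hf hpos U V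
  have h2 : g.concircular (R X₂) (L Y₁) (L Z₁) (p, q) =
      (1 / f p * g₁.hessian f Y₁ Z₁ p + κ * g₁.inner Y₁ Z₁ p) • R X₂ (p, q) := by
    rw [hC, hRL, hLL, curvature_liftRight_liftLeft_liftLeft g₁ g₂ hf hpos hX₂ hY₁ hZ₁]
    module
  have h3 : g.concircular (L X₁) (R Y₂) (R Z₂) (p, q) = (f p * g₂.inner Y₂ Z₂ q) •
      (L (g₁.nabla X₁ (g₁.gradient f)) (p, q) + (κ * f p) • L X₁ (p, q)) := by
    rw [hC, hLR, hRR, curvature_liftLeft_liftRight_liftRight g₁ g₂ hf hpos hX₁ hY₂ hZ₂]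
    module
  refine ⟨?_, h2, h3, ?_, ?_, ?_, ?_, ?_⟩
  · rw [hC, hLL, hLL, curvature_liftLeft_liftLeft_liftLeft g₁ g₂ hf hpos hX₁ hY₁ hZ₁]
  · rw [hC, hRR, hRR, curvature_liftRight_liftRight_liftRight g₁ g₂ hf hpos hX₂ hY₂ hZ₂]
    module
  · rw [hC, hLR, hLR, curvature_liftLeft_liftLeft_liftRight g₁ g₂ hf hpos hX₁ hY₁ hZ₂]
    module
  · rw [hC, hRL, hRL, curvature_liftRight_liftRight_liftLeft g₁ g₂ hf hpos hX₂ hY₂ hZ₁]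
    module
  · rw [g.concircular_swap, h2]
  · rw [g.concircular_swap, h3]
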